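/- A conjunctive query with arithmetic comparisons (CQAC) $Q$ consists of a head (a tuple of variables and constants), a finite list of relational atoms (subgoals), and a finite list $\beta$ of comparisons $X\,\theta\,Y$, where $X$ is a variable, $Y$ is a variable or a constant and $\theta\in\{<,>,\le,\ge,=,\neq\}$; every variable of the head and of $\beta$ occurs in some subgoal. Constants are rational numbers. Values are taken from a densely, totally ordered set $D$ into which $\mathbb{Q}$ is embedded in an order-preserving way (for instance $D=\mathbb{Q}$ or $D=\mathbb{R}$). The answer $Q(I)$ on a database $I$ is the set of tuples $h(\mathrm{head}(Q))$ over all assignments $h$ of values of $D$ to the variables such that all subgoals become facts of $I$ and all comparisons become true. $Q_2\sqsubseteq Q_1$ means $Q_2(I)\subseteq Q_1(I)$ for every finite database $I$. **Theorem.** Consider the instances $(Q_1,Q_2)$ where $Q_2$ is any CQAC and $Q_1$ is a CQAC among whose comparisons exactly one is not an equation (while there may be any number of equations). Then the problem of deciding $Q_2\sqsubseteq Q_1$ (numbers and names being written in binary) is in NP. Moreover, polynomially long ordered lists of containment mappings serve as certificates. For a map $\mu$ from the subgoals of $Q_1$ to those of $Q_2$ that preserves relation symbols and arities (equivalently, a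 homomorphism from the relational subgoals of the normalized $Q_1$ to those of the normalized $Q_2$) let $E_\mu$ be the set of equations between terms of $Q_2$ (and constants of $Q_1$) which express that the arguments of every subgoal of $Q_1$ are sent to those of its image, that the head of $Q_1$ is sent to the head of $Q_2$, and that the images of the equations among the comparisons of $Q_1$ hold; let $b_\mu$ be the image under $\mu$ of the comparison of $Q_1$ that is not an equation. There is a polynomial $p$ such that for all instances, with $\beta_2$ the comparisons of $Q_2$, one has $Q_2\sqsubseteq Q_1$ if and only if there is a list $\mu_1,\dots,\mu_k$ of such maps with $k\le p(\text{size of }(Q_1,Q_2))$ such that $$\beta_2\wedge\neg(E_{\mu_1}\wedge b_{\mu_1})\wedge\dots\wedge\neg(E_{\mu_{j-1}}\wedge b_{\mu_{j-1}})\Rightarrow E_{\mu_j}\quad(1\le j\le k),\qquad \beta_2\Rightarrow\bigvee_{j=1}^{k}(E_{\mu_j}\wedge b_{\mu_j})$$ hold for all assignments of values of $D$ to the variables of $Q_2$. -/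

import Mathlib

/-! ## A machine model with a step count, and the class NP -/

namespace CompModel

/-- Finite binary trees: the data on which programs operate. -/
inductive Tree where
  | nil : Tree
  | cons : Tree → Tree → Tree

namespace Tree

/-- The number of nodes, leaves included. -/
def size : Tree → ℕ
  | nil => 1
  | cons a b => a.size + b.size + 1

def hd : Tree → Tree
  | nil => nil
  | cons a _ => a

def tl : Tree → Tree
  | nil => nil
  | cons _ b => b

def ofBool : Bool → Tree
  | false => nil
  | true => cons nil nil

/-- A list `[a₁, …, aₙ]` is the tree `cons a₁ (cons a₂ (… (cons aₙ nil)))`. -/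
def ofList : List Tree → Tree
  | [] => nil
  | a :: l => cons a (ofList l)

/-- Natural numbers are written in binary (least significant bit first). -/
def ofNat (n : ℕ) : Tree := ofList (n.bits.map ofBool)

/-- A rational number is written as sign, numerator and denominator, the latter two in binary. -/
def ofRat (q : ℚ) : Tree :=
  cons (ofBool (decide (q.num < 0))) (cons (ofNat q.num.natAbs) (ofNat q.den))

end Tree

/-- The contents of the program variables `X₀, X₁, X₂, …`. -/
abbrev Store := ℕ → Tree

/-- Expressions of the WHILE language. -/
inductive Expr where
  | var : ℕ → Expr
  | nil : Expr
  | cons : Expr → Expr → Expr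
  | hd : Expr → Expr
  | tl : Expr → Expr
  | eq : Expr → Expr → Expr

namespace Expr

open Classical in
/-- The value of an expression; an equality test returns the tree of a truth value. -/
noncomputable def eval (s : Store) : Expr → Tree
  | var x => s x
  | nil => Tree.nil
  | cons e f => Tree.cons (e.eval s) (f.eval s)
  | hd e => (e.eval s).hd
  | tl e => (e.eval s).tl
  | eq e f => Tree.ofBool (decide (e.eval s = f.eval s))

/-- The number of steps for evaluating an expression. Reading a variable is charged the size of its
value, as for a machine that copies data symbol by symbol; consequently the cost is at least the
size of every value that occurs during the evaluation (up to a constant factor depending only on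
the expression), so that an equality test is paid for as well. -/
def cost (s : Store) : Expr → ℕ
  | var x => (s x).size + 1
  | nil => 1
  | cons e f => e.cost s + f.cost s + 1
  | hd e => e.cost s + 1
  | tl e => e.cost s + 1
  | eq e f => e.cost s + f.cost s + 1

end Expr

/-- Programs of the WHILE language. -/
inductive Prog where
  /-- do nothing -/
  | skip : Prog
  /-- `X := e` -/
  | assign : ℕ → Expr → Prog
  /-- sequential composition -/
  | seq : Prog → Prog → Prog
  /-- if `X` is not `nil` then the first program else the second one -/
  | branch : ℕ → Prog → Prog → Prog
  /-- while `X` is not `nil` repeat the program -/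
  | loop : ℕ → Prog → Prog

/-- `Runs c s t s'`: the program `c`, started in the store `s`, halts after exactly `t` steps in the
store `s'`. As no step can build data larger than what is charged for it, all data present after
`t` steps have total size at most (constant) × (input size + `t`); hence running times agree with
those of multitape Turing machines up to a polynomial. -/
inductive Runs : Prog → Store → ℕ → Store → Prop
  | skip (s : Store) : Runs Prog.skip s 1 s
  | assign (x : ℕ) (e : Expr) (s : Store) :
      Runs (Prog.assign x e) s (e.cost s + 1) (Function.update s x (e.eval s))
  | seq {c d : Prog} {s s' s'' : Store} {t t' : ℕ} :
      Runs c s t s' → Runs d s' t' s'' → Runs (Prog.seq c d) s (t + t') s''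
  | branch_then {x : ℕ} {c d : Prog} {s s' : Store} {t : ℕ} :
      s x ≠ Tree.nil → Runs c s t s' → Runs (Prog.branch x c d) s (t + 1) s'
  | branch_else {x : ℕ} {c d : Prog} {s s' : Store} {t : ℕ} :
      s x = Tree.nil → Runs d s t s' → Runs (Prog.branch x c d) s (t + 1) s'
  | loop_exit {x : ℕ} {c : Prog} {s : Store} :
      s x = Tree.nil → Runs (Prog.loop x c) s 1 s
  | loop_again {x : ℕ} {c : Prog} {s s' s'' : Store} {t t' : ℕ} :
      s x ≠ Tree.nil → Runs c s t s' → Runs (Prog.loop x c) s' t' s'' →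
        Runs (Prog.loop x c) s (t + t' + 1) s''

/-- The initial store: input in `X₀`, certificate in `X₁`, all other variables `nil`. -/
def initStore (w y : Tree) : Store
  | 0 => w
  | 1 => y
  | _ => Tree.nil

/-- The program halts on input `w` and certificate `y` with a value other than `nil` in `X₀`. -/
def Accepts (c : Prog) (w y : Tree) : Prop :=
  ∃ t s, Runs c (initStore w y) t s ∧ s 0 ≠ Tree.nil

/-- The decision problem "given an instance `a : α`, does `Yes a` hold?", instances being written
down by `enc`, is in NP: there is a program (a verifier) that halts on every instance and every
certificate within a number of steps polynomial in their total size, and the yes-instances are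
exactly those that have an accepted certificate of size polynomial in the size of the instance. -/
def InNP {α : Type} (enc : α → Tree) (Yes : α → Prop) : Prop :=
  ∃ (c : Prog) (time len : Polynomial ℕ),
    (∀ (a : α) (y : Tree), ∃ t s, Runs c (initStore (enc a) y) t s ∧
      t ≤ time.eval ((enc a).size + y.size)) ∧
    ∀ a : α, Yes a ↔ ∃ y : Tree, y.size ≤ len.eval (enc a).size ∧ Accepts c (enc a) y

end CompModel

/-! ## Conjunctive queries with arithmetic comparisons -/

namespace CQ

open CompModel

/-- Terms: variables `x₀, x₁, …` and rational constants. -/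
inductive Term where
  | var : ℕ → Term
  | const : ℚ → Term

/-- A relational atom `r(t₁, …, tₙ)`. -/
structure Atom where
  rel : ℕ
  args : List Term

/-- The comparison symbols `<, >, ≤, ≥, =, ≠`. -/
inductive CompOp where
  | lt | gt | le | ge | eq | ne

/-- An arithmetic comparison `X θ Y`: `X` is a variable, `Y` a variable or a constant. -/
structure Comparison where
  lhs : ℕ
  op : CompOp
  rhs : Term

/-- The comparison is an equation. -/
def Comparison.isEquation (e : Comparison) : Bool :=
  match e.op with
  | CompOp.eq => true
  | _ => false

/-- The variable `x` occurs in one of the atoms of the list. -/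
def OccursIn (x : ℕ) (body : List Atom) : Prop :=
  ∃ a ∈ body, Term.var x ∈ a.args

/-- A (safe) conjunctive query with arithmetic comparisons. -/
structure CQAC where
  head : List Term
  body : List Atom
  comps : List Comparison
  head_safe : ∀ x, Term.var x ∈ head → OccursIn x body
  comps_safe : ∀ e ∈ comps, OccursIn e.lhs body ∧ ∀ y, e.rhs = Term.var y → OccursIn y body

/-- Exactly one comparison of the query is not an equation. -/
def CQAC.HasOneAC (Q : CQAC) : Prop :=
  (Q.comps.filter fun e => !e.isEquation).length = 1

section Semantics

variable {D : Type*} [LinearOrder D]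

/-- The value of a term under an assignment `h` of the variables; `ι` interprets the constants. -/
def Term.value (ι : ℚ ↪o D) (h : ℕ → D) : Term → D
  | var x => h x
  | const c => ι c

/-- The truth of a comparison under an assignment. -/
def Comparison.Holds (ι : ℚ ↪o D) (h : ℕ → D) (e : Comparison) : Prop :=
  match e.op with
  | CompOp.lt => h e.lhs < e.rhs.value ι h
  | CompOp.gt => h e.lhs > e.rhs.value ι h
  | CompOp.le => h e.lhs ≤ e.rhs.value ι h
  | CompOp.ge => h e.lhs ≥ e.rhs.value ι h
  | CompOp.eq => h e.lhs = e.rhs.value ι h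
  | CompOp.ne => h e.lhs ≠ e.rhs.value ι h

/-- All comparisons of the query are true under the assignment. -/
def CQAC.CompsHold (ι : ℚ ↪o D) (Q : CQAC) (h : ℕ → D) : Prop :=
  ∀ e ∈ Q.comps, e.Holds ι h

/-- The answer of a query on a database; a database is a set of facts `(r, (d₁, …, dₙ))`. -/
def CQAC.answer (ι : ℚ ↪o D) (Q : CQAC) (I : Set (ℕ × List D)) : Set (List D) :=
  {u | ∃ h : ℕ → D, (∀ a ∈ Q.body, (a.rel, a.args.map (Term.value ι h)) ∈ I) ∧
    Q.CompsHold ι h ∧ u = Q.head.map (Term.value ι h)}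

/-- Query containment `Q₂ ⊑ Q₁`. -/
def Contained (ι : ℚ ↪o D) (Q₂ Q₁ : CQAC) : Prop :=
  ∀ I : Set (ℕ × List D), I.Finite → Q₂.answer ι I ⊆ Q₁.answer ι I

end Semantics

/-! ### Lists of containment mappings -/

/-- A containment mapping from the normalized `Q₁` to the normalized `Q₂`. In a normalized query
every argument position of a relational subgoal carries its own variable, so that a mapping of the
variables that sends subgoals to subgoals amounts to a mapping of subgoals that preserves the
relation symbol and the arity. What normalization moves into equations (repeated variables, and
constants in subgoals), as well as the matching of the heads, is taken care of by `Matches`. -/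
structure ContainmentMapping (Q₁ Q₂ : CQAC) where
  toFun : Fin Q₁.body.length → Fin Q₂.body.length
  rel_eq : ∀ i, (Q₁.body.get i).rel = (Q₂.body.get (toFun i)).rel
  arity_eq : ∀ i, (Q₁.body.get i).args.length = (Q₂.body.get (toFun i)).args.length

section Entailment

variable {D : Type*} [LinearOrder D] {Q₁ Q₂ : CQAC}

/-- The values `g` of the variables of `Q₁` are those which the mapping `μ` prescribes when the
variables of `Q₂` have the values `h`. -/
def ContainmentMapping.Matches (ι : ℚ ↪o D) (μ : ContainmentMapping Q₁ Q₂) (h g : ℕ → D) : Prop :=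
  (∀ i, (Q₁.body.get i).args.map (Term.value ι g) =
    (Q₂.body.get (μ.toFun i)).args.map (Term.value ι h)) ∧
  Q₁.head.map (Term.value ι g) = Q₂.head.map (Term.value ι h)

/-- The images under `μ` of all equations of the normalized `Q₁` are true under `h`. -/
def ContainmentMapping.EquationsHold (ι : ℚ ↪o D) (μ : ContainmentMapping Q₁ Q₂) (h : ℕ → D) :
    Prop :=
  ∃ g, μ.Matches ι h g ∧ ∀ e ∈ Q₁.comps, e.isEquation = true → e.Holds ι g

/-- The images under `μ` of all comparisons of the normalized `Q₁` are true under `h`. -/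
def ContainmentMapping.CompsHold (ι : ℚ ↪o D) (μ : ContainmentMapping Q₁ Q₂) (h : ℕ → D) : Prop :=
  ∃ g, μ.Matches ι h g ∧ Q₁.CompsHold ι g

/-- The list `μ₁, …, μₖ` certifies `Q₂ ⊑ Q₁`, the comparisons being `β₂` and `β₁`: for each `j`
the equations in `μⱼ(β₁)` follow from `β₂ ∧ ¬ μ₁(β₁) ∧ … ∧ ¬ μⱼ₋₁(β₁)`, and
`β₂` implies `μ₁(β₁) ∨ … ∨ μₖ(β₁)`. (As the equations in `μᵢ(β₁)`, `i < j`, have been derived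
before, `¬ μᵢ(β₁)` says here that the image of the only comparison of `Q₁` that is not
an equation is false.) -/
def Certifies (ι : ℚ ↪o D) (L : List (ContainmentMapping Q₁ Q₂)) : Prop :=
  (∀ j : Fin L.length, ∀ h : ℕ → D, Q₂.CompsHold ι h →
    (∀ i : Fin L.length, i < j → ¬ (L.get i).CompsHold ι h) → (L.get j).EquationsHold ι h) ∧
  ∀ h : ℕ → D, Q₂.CompsHold ι h → ∃ μ ∈ L, μ.CompsHold ι h

end Entailment

/-! ### The decision problem -/

def Term.encode : Term → Tree
  | var x => Tree.cons (Tree.ofBool false) (Tree.ofNat x)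
  | const c => Tree.cons (Tree.ofBool true) (Tree.ofRat c)

def Atom.encode (a : Atom) : Tree :=
  Tree.cons (Tree.ofNat a.rel) (Tree.ofList (a.args.map Term.encode))

def CompOp.encode : CompOp → Tree
  | lt => Tree.ofNat 0
  | gt => Tree.ofNat 1
  | le => Tree.ofNat 2
  | ge => Tree.ofNat 3
  | eq => Tree.ofNat 4
  | ne => Tree.ofNat 5

def Comparison.encode (e : Comparison) : Tree :=
  Tree.cons e.op.encode (Tree.cons (Tree.ofNat e.lhs) e.rhs.encode)

def CQAC.encode (Q : CQAC) : Tree :=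
  Tree.cons (Tree.ofList (Q.head.map Term.encode))
    (Tree.cons (Tree.ofList (Q.body.map Atom.encode))
      (Tree.ofList (Q.comps.map Comparison.encode)))

/-- The instances: pairs of queries, the contained one `Q₂` arbitrary, the containing one `Q₁` with
exactly one comparison that is not an equation. -/
structure Instance where
  Q₂ : CQAC
  Q₁ : CQAC
  oneAC : Q₁.HasOneAC

def Instance.encode (a : Instance) : Tree := Tree.cons a.Q₂.encode a.Q₁.encode

end CQ

/-! ## A language of bounded tests and its compilation -/

/-! Consider a set `F` of facts `t ≤ u`, `t < u`, `t ≠ u` between the terms of both queries that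
contains the comparisons of `Q₂` and is closed under the laws of order. If `F` contains no `t < t`,
then it has a model in which two terms have equal values only if `F` proves them equal
(`Closed.exists_model`): the constants keep their values, and the remaining terms are inserted one
after another into ℚ, each at the value of an equivalent term or strictly between the values already
used.

Containment provides a mapping `μ` for this model with all of `μ(β₁)` true (`contained_iff`, by the
canonical database). The equations in `E_μ` hold in the model, so `F` proves them. The single
remaining comparison `b_μ` is also true there, so some fact contained in its negation fails in the
model and is missing from `F` (`Closed.exists_applicable`). As `E_μ` is derived and only one other
comparison is left, the failure of `μ` amounts to a conjunction of facts, without case distinctions.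
Adding it enlarges `F`. With `n` terms there are at most `3 n²` facts, so after that many steps at
most a contradiction `t < t` appears.

The argument is used for two choices of `F`. If `F` is the set of semantic consequences of `β₂` and
of the failure of the mappings chosen so far, the chosen mappings form the ordered list
(`IsOrdered.exists_certifies`). If `F` is the set of facts stated in a formal derivation, the result
is a refutation of polynomial size (`Line.exists_contradiction`), which serves as the NP
certificate. Its rules include binary addition and multiplication, so that comparisons of rational
constants are also derived line by line.

Correctness of each line is a property with quantifiers over list entries or suffixes only. Such
properties form a small formula language that compiles to WHILE programs with polynomial running
time (`Fm.decides_compile`, `inNP_of_checkable`). Soundness of the rules (`Justified.sound`) shows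
that only true containments have refutations. -/

namespace CompModel

namespace Tree

/-- The elements of a tree that is read as a list. -/
def toList : Tree → List Tree
  | nil => []
  | cons a b => a :: toList b

/-- The nonempty suffixes of a tree that is read as a list. -/
def suffixes : Tree → List Tree
  | nil => []
  | cons a b => cons a b :: suffixes b

@[simp] theorem hd_nil : (nil : Tree).hd = nil := rfl
@[simp] theorem tl_nil : (nil : Tree).tl = nil := rfl
@[simp] theorem hd_cons (a b : Tree) : (cons a b).hd = a := rfl
@[simp] theorem tl_cons (a b : Tree) : (cons a b).tl = b := rfl

@[simp] theorem toList_ofList (l : List Tree) : (ofList l).toList = l := by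
  induction l with
  | nil => rfl
  | cons a l ih => simp [ofList, toList, ih]

theorem exists_suffixes_hd {t : Tree} {p : Tree → Prop} :
    (∃ s ∈ t.suffixes, p s.hd) ↔ ∃ a ∈ t.toList, p a := by
  induction t with
  | nil => simp [suffixes, toList]
  | cons a b _ ih => simp [suffixes, toList, ih]

theorem size_pos (t : Tree) : 0 < t.size := by
  cases t <;> simp [size]

theorem size_hd_le (t : Tree) : t.hd.size ≤ t.size := by
  cases t <;> simp [size, hd]; omega

theorem size_tl_le (t : Tree) : t.tl.size ≤ t.size := by
  cases t <;> simp [size, tl]; omega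

theorem ofBool_ne_nil {b : Bool} : ofBool b ≠ nil ↔ b = true := by
  cases b <;> simp [ofBool]

end Tree

/-- Acceptance asks for some accepting run; determinism identifies it with the run that is
constructed for the compiled program. -/
theorem Runs.deterministic {c : Prog} {s s₁ s₂ : Store} {t₁ t₂ : ℕ}
    (h₁ : Runs c s t₁ s₁) (h₂ : Runs c s t₂ s₂) : t₁ = t₂ ∧ s₁ = s₂ := by
  induction h₁ generalizing t₂ s₂ with
  | skip => cases h₂; exact ⟨rfl, rfl⟩
  | assign => cases h₂; exact ⟨rfl, rfl⟩
  | seq _ _ ih ih' =>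
    cases h₂ with
    | seq a b =>
      obtain ⟨rfl, rfl⟩ := ih a
      obtain ⟨rfl, rfl⟩ := ih' b
      exact ⟨rfl, rfl⟩
  | branch_then h _ ih =>
    cases h₂ with
    | branch_then _ a => obtain ⟨rfl, rfl⟩ := ih a; exact ⟨rfl, rfl⟩
    | branch_else h' _ => exact absurd h' h
  | branch_else h _ ih =>
    cases h₂ with
    | branch_then h' _ => exact absurd h h'
    | branch_else _ a => obtain ⟨rfl, rfl⟩ := ih a; exact ⟨rfl, rfl⟩
  | loop_exit h =>
    cases h₂ with
    | loop_exit => exact ⟨rfl, rfl⟩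
    | loop_again h' _ _ => exact absurd h h'
  | loop_again h _ _ ih ih' =>
    cases h₂ with
    | loop_exit h' => exact absurd h' h
    | loop_again _ a b =>
      obtain ⟨rfl, rfl⟩ := ih a
      obtain ⟨rfl, rfl⟩ := ih' b
      exact ⟨rfl, rfl⟩

/-- The coefficients are natural numbers, hence nonnegative. -/
theorem eval_mono (p : Polynomial ℕ) {m n : ℕ} (h : m ≤ n) :
    p.eval m ≤ p.eval n := by
  rw [Polynomial.eval_eq_sum, Polynomial.eval_eq_sum]
  exact Finset.sum_le_sum fun i _ => Nat.mul_le_mul_left _ (Nat.pow_le_pow_left h i)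

/-- Terms over an environment that consists of a single tree. -/
inductive Tm where
  | env : Tm
  | nil : Tm
  | cons : Tm → Tm → Tm
  | hd : Tm → Tm
  | tl : Tm → Tm

namespace Tm

def eval (v : Tree) : Tm → Tree
  | env => v
  | nil => Tree.nil
  | cons a b => Tree.cons (a.eval v) (b.eval v)
  | hd a => (a.eval v).hd
  | tl a => (a.eval v).tl

/-- The expression that evaluates a term, the environment being stored in `X_k`. -/
def toExpr (k : ℕ) : Tm → Expr
  | env => Expr.var k
  | nil => Expr.nil
  | cons a b => Expr.cons (a.toExpr k) (b.toExpr k)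
  | hd a => Expr.hd (a.toExpr k)
  | tl a => Expr.tl (a.toExpr k)

/-- A constant `c` such that `c * (|v| + 1)` bounds both the cost of evaluation and the size of the
value. -/
def weight : Tm → ℕ
  | env => 1
  | nil => 1
  | cons a b => a.weight + b.weight + 1
  | hd a => a.weight + 1
  | tl a => a.weight + 1

theorem eval_toExpr (a : Tm) (k : ℕ) (s : Store) : (a.toExpr k).eval s = a.eval (s k) := by
  induction a <;> simp_all [toExpr, Expr.eval, eval]

theorem cost_toExpr_le (a : Tm) (k : ℕ) (s : Store) :
    (a.toExpr k).cost s ≤ a.weight * ((s k).size + 1) := by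
  induction a <;> simp only [toExpr, Expr.cost, weight] <;> nlinarith

theorem size_eval_le (a : Tm) (v : Tree) : (a.eval v).size ≤ a.weight * (v.size + 1) := by
  induction a with
  | env => simp [eval, weight]
  | nil => simp [eval, weight, Tree.size]
  | cons a b iha ihb => simp only [eval, weight, Tree.size]; nlinarith
  | hd a ih => simp only [eval, weight]; nlinarith [Tree.size_hd_le (a.eval v)]
  | tl a ih => simp only [eval, weight]; nlinarith [Tree.size_tl_le (a.eval v)]

end Tm

/-- Formulas whose quantifier ranges over the nonempty suffixes of a list; the suffix is put in
front of the environment. -/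
inductive Fm where
  | eq : Tm → Tm → Fm
  | not : Fm → Fm
  | and : Fm → Fm → Fm
  | ex : Tm → Fm → Fm

namespace Fm

def Sat : Fm → Tree → Prop
  | eq a b, v => a.eval v = b.eval v
  | not φ, v => ¬ φ.Sat v
  | and φ ψ, v => φ.Sat v ∧ ψ.Sat v
  | ex a φ, v => ∃ s ∈ (a.eval v).suffixes, φ.Sat (Tree.cons s v)

/-- The body of the loop that searches the suffixes. -/
def searchBody (k : ℕ) (c : Prog) : Prog :=
  Prog.seq (Prog.assign (k + 2) (Expr.cons (Expr.var (k + 1)) (Expr.var k)))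
    (Prog.seq c
      -- A hit empties the list pointer, which ends the loop while `X₀` still holds the value true.
      (Prog.branch 0 (Prog.assign (k + 1) Expr.nil)
        (Prog.assign (k + 1) (Expr.tl (Expr.var (k + 1))))))

/-- The program that evaluates a formula, the environment being stored in `X_k`; the truth value is
left in `X₀`. -/
def compile : ℕ → Fm → Prog
  | k, eq a b => Prog.assign 0 (Expr.eq (a.toExpr k) (b.toExpr k))
  | k, not φ => Prog.seq (φ.compile k)
      (Prog.branch 0 (Prog.assign 0 Expr.nil) (Prog.assign 0 (Expr.cons Expr.nil Expr.nil)))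
  | k, and φ ψ => Prog.seq (φ.compile k) (Prog.branch 0 (ψ.compile k) Prog.skip)
  -- `X₀` is cleared first because the loop does not run at all on an empty list.
  | k, ex a φ => Prog.seq (Prog.assign 0 Expr.nil) (Prog.seq (Prog.assign (k + 1) (a.toExpr k))
      (Prog.loop (k + 1) (searchBody k (φ.compile (k + 2)))))

/-- The running time of the compiled formula in terms of the size of the environment. -/
noncomputable def time : Fm → Polynomial ℕ
  | eq a b => Polynomial.C (a.weight + b.weight) * (Polynomial.X + 1) + 2
  | not φ => φ.time + 5
  | and φ ψ => φ.time + ψ.time + 2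
  -- `C a.weight * (X + 1)` bounds the size of the searched list, hence both the number of rounds
  -- and the size of each suffix that is put in front of the environment.
  | ex a φ => Polynomial.C a.weight * (Polynomial.X + 1) + 10 +
      Polynomial.C a.weight * (Polynomial.X + 1) *
        (2 * (Polynomial.C a.weight * (Polynomial.X + 1)) + Polynomial.X + 12 +
          φ.time.comp (Polynomial.C a.weight * (Polynomial.X + 1) + Polynomial.X + 1))

/-- The program decides the predicate on the content of `X_k` within the time bound and does not
change `X₁, …, X_k`. -/
def Decides (c : Prog) (k : ℕ) (P : Tree → Prop) (p : Polynomial ℕ) : Prop :=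
  ∀ s : Store, ∃ t s', Runs c s t s' ∧ (P (s k) → s' 0 = Tree.ofBool true) ∧
    (¬ P (s k) → s' 0 = Tree.ofBool false) ∧
    (∀ x, 1 ≤ x → x ≤ k → s' x = s x) ∧ t ≤ p.eval (s k).size

/-- Induction on the list still to be searched. The bound `M` refers to the initial list and stays
fixed, so that every round is charged the same amount. -/
theorem runs_search {c : Prog} {k : ℕ} {P : Tree → Prop} {p : Polynomial ℕ} (hk : 1 ≤ k)
    (hc : Decides c (k + 2) P p) (u v : Tree) (M : ℕ) (s : Store) (hs : s (k + 1) = u)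
    (hv : s k = v) (h0 : s 0 = Tree.ofBool false) (hu : u.size ≤ M) :
    ∃ t s', Runs (Prog.loop (k + 1) (searchBody k c)) s t s' ∧
      ((∃ w ∈ u.suffixes, P (Tree.cons w v)) → s' 0 = Tree.ofBool true) ∧
      ((¬ ∃ w ∈ u.suffixes, P (Tree.cons w v)) → s' 0 = Tree.ofBool false) ∧
      (∀ x, 1 ≤ x → x ≤ k → s' x = s x) ∧
      t ≤ u.size * (2 * M + v.size + 12 + p.eval (M + v.size + 1)) + 1 := by
  induction u generalizing s with
  | nil =>
    refine ⟨1, s, Runs.loop_exit hs, ?_, fun _ => h0, fun _ _ _ => rfl, by omega⟩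
    simp [Tree.suffixes]
  | cons a b _ ih =>
    set u := Tree.cons a b with hu'
    set s₁ := Function.update s (k + 2) (Tree.cons u v) with hs₁
    have r₁ : Runs (Prog.assign (k + 2) (Expr.cons (Expr.var (k + 1)) (Expr.var k))) s
        (u.size + v.size + 4) s₁ := by
      have := Runs.assign (k + 2) (Expr.cons (Expr.var (k + 1)) (Expr.var k)) s
      simp only [Expr.cost, Expr.eval, hs, hv] at this
      convert this using 1
      ring
    obtain ⟨t₂, s₂, r₂, hyes, hno, hfr, ht₂⟩ := hc s₁
    have e₁ : s₁ (k + 2) = Tree.cons u v := by simp [hs₁]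
    rw [e₁] at hyes hno ht₂
    have fr₂ : ∀ x, 1 ≤ x → x ≤ k + 1 → s₂ x = s x := by
      intro x h1 h2
      rw [hfr x h1 (by omega), hs₁, Function.update_of_ne (by omega)]
    have ht₂' : t₂ ≤ p.eval (M + v.size + 1) :=
      ht₂.trans (eval_mono p (by simp only [Tree.size] at hu ⊢; omega))
    have hune : s (k + 1) ≠ Tree.nil := by rw [hs, hu']; simp
    have hsz : u.size = a.size + b.size + 1 := rfl
    have hasz := a.size_pos
    by_cases hP : P (Tree.cons u v)
    · have h2 : s₂ 0 ≠ Tree.nil := by rw [hyes hP]; simp [Tree.ofBool]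
      set s₃ := Function.update s₂ (k + 1) Tree.nil with hs₃
      have r₃ := Runs.branch_then (d := Prog.assign (k + 1) (Expr.tl (Expr.var (k + 1)))) h2
        (Runs.assign (k + 1) Expr.nil s₂)
      have r₄ : Runs (Prog.loop (k + 1) (searchBody k c)) s₃ 1 s₃ :=
        Runs.loop_exit (by simp [hs₃])
      refine ⟨_, s₃, Runs.loop_again hune (r₁.seq (r₂.seq r₃)) r₄, ?_, ?_, ?_, ?_⟩
      · intro _
        rw [hs₃, Function.update_of_ne (by omega), hyes hP]
      · intro h
        exact absurd ⟨u, by simp [hu', Tree.suffixes], hP⟩ h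
      · intro x h1 h3
        rw [hs₃, Function.update_of_ne (by omega), fr₂ x h1 (by omega)]
      · simp only [Expr.cost]
        nlinarith
    · have h2 : s₂ 0 = Tree.nil := by rw [hno hP]; rfl
      have r₃ := Runs.branch_else (c := Prog.assign (k + 1) Expr.nil) h2
        (Runs.assign (k + 1) (Expr.tl (Expr.var (k + 1))) s₂)
      have e₂ : s₂ (k + 1) = u := by rw [fr₂ _ (by omega) le_rfl, hs]
      simp only [Expr.eval, e₂, hu', Tree.tl_cons, Expr.cost] at r₃
      set s₃ := Function.update s₂ (k + 1) b with hs₃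
      obtain ⟨t₄, s₄, r₄, hyes₄, hno₄, hfr₄, ht₄⟩ := ih s₃ (by simp [hs₃])
        (by rw [hs₃, Function.update_of_ne (by omega), fr₂ k hk (by omega), hv])
        (by rw [hs₃, Function.update_of_ne (by omega), h2]; rfl) (by omega)
      have hiff : (∃ w ∈ u.suffixes, P (Tree.cons w v)) ↔
          ∃ w ∈ b.suffixes, P (Tree.cons w v) := by
        rw [hu', Tree.suffixes, ← hu']
        simp [hP]
      refine ⟨_, s₄, Runs.loop_again hune (r₁.seq (r₂.seq r₃)) r₄, ?_, ?_, ?_, ?_⟩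
      · rwa [hiff]
      · rwa [hiff]
      · intro x h1 h3
        rw [hfr₄ x h1 h3, hs₃, Function.update_of_ne (by omega), fr₂ x h1 (by omega)]
      · have : (Tree.cons a b).size = u.size := rfl
        nlinarith

/-- Below a quantifier the environment moves to `X_{k+2}`; since a program for index `k + 2`
preserves `X₁, …, X_{k+2}`, the outer environment and the loop pointer survive. Nesting is fixed by
the formula, so the time bounds compose to a polynomial. -/
theorem decides_compile (φ : Fm) (k : ℕ) (hk : 1 ≤ k) : Decides (φ.compile k) k φ.Sat φ.time := by
  induction φ generalizing k with
  | eq a b =>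
    intro s
    refine ⟨_, _, Runs.assign 0 _ s, ?_, ?_, ?_, ?_⟩
    · intro h
      have h' : a.eval (s k) = b.eval (s k) := h
      simp [Expr.eval, Tm.eval_toExpr, h']
    · intro h
      have h' : ¬ a.eval (s k) = b.eval (s k) := h
      simp [Expr.eval, Tm.eval_toExpr, h']
    · intro x h1 _
      rw [Function.update_of_ne (by omega)]
    · have h1 := a.cost_toExpr_le k s
      have h2 := b.cost_toExpr_le k s
      simp only [Expr.cost, time, Polynomial.eval_add, Polynomial.eval_mul, Polynomial.eval_C,
        Polynomial.eval_X, Polynomial.eval_one, Polynomial.eval_ofNat]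
      linarith
  | not φ ih =>
    intro s
    obtain ⟨t, s', r, hyes, hno, hfr, ht⟩ := ih k hk s
    by_cases h : φ.Sat (s k)
    · refine ⟨_, _, r.seq (Runs.branch_then (by rw [hyes h]; simp [Tree.ofBool])
        (Runs.assign _ _ _)), fun h' => absurd h h', ?_, ?_, ?_⟩
      · intro _; simp [Expr.eval, Tree.ofBool]
      · intro x h1 h2
        rw [Function.update_of_ne (by omega), hfr x h1 h2]
      · simp [time, Expr.cost]; omega
    · refine ⟨_, _, r.seq (Runs.branch_else (by rw [hno h]; simp [Tree.ofBool])
        (Runs.assign _ _ _)), ?_, fun h' => absurd h h', ?_, ?_⟩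
      · intro _; simp [Expr.eval, Tree.ofBool]
      · intro x h1 h2
        rw [Function.update_of_ne (by omega), hfr x h1 h2]
      · simp [time, Expr.cost]; omega
  | and φ ψ ih ih' =>
    intro s
    obtain ⟨t, s', r, hyes, hno, hfr, ht⟩ := ih k hk s
    obtain ⟨t', s'', r', hyes', hno', hfr', ht'⟩ := ih' k hk s'
    rw [hfr k hk le_rfl] at hyes' hno' ht'
    by_cases h : φ.Sat (s k)
    · refine ⟨_, _, r.seq (Runs.branch_then (by rw [hyes h]; simp [Tree.ofBool]) r'),
        fun h' => hyes' h'.2, fun h' => hno' fun h2 => h' ⟨h, h2⟩, ?_, ?_⟩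
      · intro x h1 h2
        rw [hfr' x h1 h2, hfr x h1 h2]
      · simp [time]; omega
    · refine ⟨_, _, r.seq (Runs.branch_else (by rw [hno h]; simp [Tree.ofBool]) (Runs.skip _)),
        fun h' => absurd h'.1 h, fun _ => hno h, hfr, ?_⟩
      simp [time]; omega
  | ex a φ ih =>
    intro s
    have r₁ := Runs.assign 0 Expr.nil s
    set s₁ := Function.update s 0 (Expr.nil.eval s) with hs₁
    have r₂ := Runs.assign (k + 1) (a.toExpr k) s₁
    set s₂ := Function.update s₁ (k + 1) ((a.toExpr k).eval s₁) with hs₂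
    have e₁ : s₁ k = s k := by rw [hs₁, Function.update_of_ne (by omega)]
    have hsz := a.size_eval_le (s k)
    obtain ⟨t, s', r, hyes, hno, hfr, ht⟩ := runs_search hk (ih (k + 2) (by omega))
      (a.eval (s k)) (s k) (a.weight * ((s k).size + 1)) s₂
      (by simp [hs₂, Tm.eval_toExpr, e₁]) (by rw [hs₂, Function.update_of_ne (by omega), e₁])
      (by rw [hs₂, Function.update_of_ne (by omega)]; simp [hs₁, Expr.eval, Tree.ofBool]) hsz
    refine ⟨_, s', r₁.seq (r₂.seq r), hyes, hno, ?_, ?_⟩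
    · intro x h1 h2
      rw [hfr x h1 h2, hs₂, Function.update_of_ne (by omega), hs₁,
        Function.update_of_ne (by omega)]
    · have h2 := a.cost_toExpr_le k s₁
      rw [e₁] at h2
      simp only [Expr.cost, time, Polynomial.eval_add, Polynomial.eval_mul, Polynomial.eval_C,
        Polynomial.eval_X, Polynomial.eval_one, Polynomial.eval_ofNat, Polynomial.eval_comp]
      have h3 := Nat.mul_le_mul_right (2 * (a.weight * ((s k).size + 1)) + (s k).size + 12 +
        φ.time.eval (a.weight * ((s k).size + 1) + (s k).size + 1)) hsz
      omega

end Fm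

/-! ### Closure properties of checkable predicates -/

/-- A function that is given by a term. -/
def IsTm (f : Tree → Tree) : Prop := ∃ a : Tm, ∀ v, a.eval v = f v

/-- A predicate that is given by a formula. -/
def Checkable (P : Tree → Prop) : Prop := ∃ φ : Fm, ∀ v, φ.Sat v ↔ P v

namespace IsTm

theorem env : IsTm fun v => v := ⟨Tm.env, fun _ => rfl⟩
theorem nil : IsTm fun _ => Tree.nil := ⟨Tm.nil, fun _ => rfl⟩

variable {f g : Tree → Tree}

theorem cons (hf : IsTm f) (hg : IsTm g) : IsTm fun v => Tree.cons (f v) (g v) := by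
  obtain ⟨a, ha⟩ := hf
  obtain ⟨b, hb⟩ := hg
  exact ⟨Tm.cons a b, fun v => by simp [Tm.eval, ha, hb]⟩

theorem hd (hf : IsTm f) : IsTm fun v => (f v).hd := by
  obtain ⟨a, ha⟩ := hf
  exact ⟨Tm.hd a, fun v => by simp [Tm.eval, ha]⟩

theorem tl (hf : IsTm f) : IsTm fun v => (f v).tl := by
  obtain ⟨a, ha⟩ := hf
  exact ⟨Tm.tl a, fun v => by simp [Tm.eval, ha]⟩

end IsTm

namespace Checkable

variable {f g : Tree → Tree} {P R : Tree → Prop}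

theorem eq (hf : IsTm f) (hg : IsTm g) : Checkable fun v => f v = g v := by
  obtain ⟨a, ha⟩ := hf
  obtain ⟨b, hb⟩ := hg
  exact ⟨Fm.eq a b, fun v => by simp [Fm.Sat, ha, hb]⟩

theorem not (hP : Checkable P) : Checkable fun v => ¬ P v := by
  obtain ⟨φ, h⟩ := hP
  exact ⟨Fm.not φ, fun v => by simp [Fm.Sat, h]⟩

theorem ne (hf : IsTm f) (hg : IsTm g) : Checkable fun v => f v ≠ g v := (eq hf hg).not

theorem and (hP : Checkable P) (hR : Checkable R) : Checkable fun v => P v ∧ R v := by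
  obtain ⟨φ, h⟩ := hP
  obtain ⟨ψ, h'⟩ := hR
  exact ⟨Fm.and φ ψ, fun v => by simp [Fm.Sat, h, h']⟩

theorem of_iff (hP : Checkable P) (h : ∀ v, P v ↔ R v) : Checkable R := by
  obtain ⟨φ, h'⟩ := hP
  exact ⟨φ, fun v => (h' v).trans (h v)⟩

theorem or (hP : Checkable P) (hR : Checkable R) : Checkable fun v => P v ∨ R v :=
  (hP.not.and hR.not).not.of_iff fun _ => by tauto

theorem imp (hP : Checkable P) (hR : Checkable R) : Checkable fun v => P v → R v :=
  (hP.and hR.not).not.of_iff fun _ => by tauto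

theorem iff (hP : Checkable P) (hR : Checkable R) : Checkable fun v => P v ↔ R v :=
  ((hP.imp hR).and (hR.imp hP)).of_iff fun _ => by tauto

theorem exists_suffix {B : Tree → Tree → Prop} (hf : IsTm f)
    (hB : Checkable fun v => B v.hd v.tl) : Checkable fun v => ∃ s ∈ (f v).suffixes, B s v := by
  obtain ⟨a, ha⟩ := hf
  obtain ⟨φ, h⟩ := hB
  exact ⟨Fm.ex a φ, fun v => by simp [Fm.Sat, h, ha]⟩

theorem forall_suffix {B : Tree → Tree → Prop} (hf : IsTm f)
    (hB : Checkable fun v => B v.hd v.tl) : Checkable fun v => ∀ s ∈ (f v).suffixes, B s v :=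
  (exists_suffix (B := fun s v => ¬ B s v) hf hB.not).not.of_iff fun v => by simp

theorem exists_mem {B : Tree → Tree → Prop} (hf : IsTm f)
    (hB : Checkable fun v => B v.hd.hd v.tl) : Checkable fun v => ∃ a ∈ (f v).toList, B a v :=
  (exists_suffix (B := fun s v => B s.hd v) hf hB).of_iff fun v =>
    Tree.exists_suffixes_hd (p := fun a => B a v)

theorem forall_mem {B : Tree → Tree → Prop} (hf : IsTm f)
    (hB : Checkable fun v => B v.hd.hd v.tl) : Checkable fun v => ∀ a ∈ (f v).toList, B a v :=
  (exists_mem (B := fun s v => ¬ B s v) hf hB.not).not.of_iff fun v => by simp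

theorem mem (hf : IsTm f) (hg : IsTm g) : Checkable fun v => f v ∈ (g v).toList := by
  obtain ⟨a, ha⟩ := hf
  refine (exists_mem (B := fun b v => f v = b) hg (eq ?_ (IsTm.env.hd.hd))).of_iff fun v => by simp
  -- Under the new quantifier the old environment is the tail of the current one, so every reference
  -- to the environment is shifted by `tl`.
  have : ∀ b : Tm, ∃ c : Tm, ∀ v, c.eval v = b.eval v.tl := by
    intro b
    induction b with
    | env => exact ⟨Tm.tl Tm.env, fun _ => rfl⟩
    | nil => exact ⟨Tm.nil, fun _ => rfl⟩
    | cons a b iha ihb =>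
      obtain ⟨c, hc⟩ := iha
      obtain ⟨d, hd⟩ := ihb
      exact ⟨Tm.cons c d, fun v => by simp [Tm.eval, hc, hd]⟩
    | hd a ih => obtain ⟨c, hc⟩ := ih; exact ⟨Tm.hd c, fun v => by simp [Tm.eval, hc]⟩
    | tl a ih => obtain ⟨c, hc⟩ := ih; exact ⟨Tm.tl c, fun v => by simp [Tm.eval, hc]⟩
  obtain ⟨c, hc⟩ := this a
  exact ⟨c, fun v => by rw [hc, ha]⟩

end Checkable

/-- A problem whose yes-instances have polynomially long certificates that a checkable predicate
verifies is in NP. -/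
theorem inNP_of_checkable {α : Type} {enc : α → Tree} {Yes : α → Prop} {P : Tree → Prop}
    (hP : Checkable P) (len : Polynomial ℕ)
    (sound : ∀ a y, P (Tree.cons (enc a) y) → Yes a)
    (complete : ∀ a, Yes a → ∃ y : Tree, y.size ≤ len.eval (enc a).size ∧
      P (Tree.cons (enc a) y)) : InNP enc Yes := by
  obtain ⟨φ, hφ⟩ := hP
  -- Instance and certificate are paired in `X₂`, because `X₀` is overwritten by truth values.
  set c := Prog.seq (Prog.assign 2 (Expr.cons (Expr.var 0) (Expr.var 1))) (φ.compile 2) with hc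
  have run : ∀ w y, ∃ t s, Runs c (initStore w y) t s ∧ (s 0 ≠ Tree.nil ↔ P (Tree.cons w y)) ∧
      t ≤ w.size + y.size + 4 + φ.time.eval (w.size + y.size + 1) := by
    intro w y
    have r := Runs.assign 2 (Expr.cons (Expr.var 0) (Expr.var 1)) (initStore w y)
    set s₁ := Function.update (initStore w y) 2
      ((Expr.cons (Expr.var 0) (Expr.var 1)).eval (initStore w y)) with hs₁
    have e : s₁ 2 = Tree.cons w y := by simp [hs₁, Expr.eval, initStore]
    obtain ⟨t, s, r', hyes, hno, -, ht⟩ := φ.decides_compile 2 (by omega) s₁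
    rw [e] at hyes hno ht
    refine ⟨_, s, r.seq r', ?_, ?_⟩
    · rw [← hφ]
      by_cases h : φ.Sat (Tree.cons w y)
      · simp [h, hyes h, Tree.ofBool]
      · simp [h, hno h, Tree.ofBool]
    · simp only [Tree.size] at ht
      simp only [Expr.cost, initStore]
      omega
  have acc : ∀ w y, Accepts c w y ↔ P (Tree.cons w y) := by
    intro w y
    obtain ⟨t, s, r, h, -⟩ := run w y
    constructor
    · rintro ⟨t', s', r', h'⟩
      obtain ⟨-, rfl⟩ := r.deterministic r'
      exact h.1 h'
    · intro hp
      exact ⟨t, s, r, h.2 hp⟩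
  refine ⟨c, Polynomial.X + 4 + φ.time.comp (Polynomial.X + 1), len, ?_, ?_⟩
  · intro a y
    obtain ⟨t, s, r, -, ht⟩ := run (enc a) y
    exact ⟨t, s, r, by simpa using ht⟩
  · intro a
    simp only [acc]
    exact ⟨complete a, fun ⟨y, _, hy⟩ => sound a y hy⟩

end CompModel

/-! ## Derivations as certificates -/

namespace CompModel

/-! ### Decoding of binary numbers and rationals -/

namespace Tree

/-- The number with the given binary digits, least significant first. -/
def num : Tree → ℕ
  | nil => 0
  | cons nil b => 2 * num b
  | cons (cons _ _) b => 2 * num b + 1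

open Classical in
/-- The digit `0` or `1` that a tree stands for. -/
noncomputable def digit (t : Tree) : ℕ := if t = nil then 0 else 1

open Classical in
/-- The rational number with the given sign, numerator and denominator. -/
noncomputable def rat (t : Tree) : ℚ :=
  (if t.hd = nil then (t.tl.hd.num : ℚ) else -(t.tl.hd.num : ℚ)) / t.tl.tl.num

/-- Every tree denotes a number: entries other than `nil` count as the digit 1, and `nil` continues
with zeros. Soundness therefore needs no test that a certificate is well formed. -/
theorem num_eq (t : Tree) : t.num = t.hd.digit + 2 * t.tl.num := by
  match t with
  | nil => simp [num, digit]
  | cons nil b => simp [num, digit]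
  | cons (cons _ _) b => simp [num, digit, add_comm]

theorem num_ofNat (n : ℕ) : (ofNat n).num = n := by
  induction n using Nat.binaryRec' with
  | zero => simp [ofNat, ofList, num]
  | bit b n h ih =>
    rw [ofNat, Nat.bits_append_bit n b h]
    cases b <;> simp only [List.map_cons, ofList, ofBool, num] <;> rw [← ofNat, ih] <;>
      simp [Nat.bit]

theorem ofNat_injective : Function.Injective ofNat := fun m n h => by
  rw [← num_ofNat m, h, num_ofNat]

theorem rat_ofRat (q : ℚ) : (ofRat q).rat = q := by
  have h := Rat.num_div_den q
  by_cases hq : q.num < 0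
  · simp only [ofRat, rat, hd_cons, tl_cons, num_ofNat, hq, decide_true, ofBool, reduceCtorEq,
      if_false]
    rw [Nat.cast_natAbs, abs_of_neg hq]
    push_cast
    rw [neg_neg, h]
  · simp only [ofRat, rat, hd_cons, tl_cons, num_ofNat, hq, decide_false, ofBool, if_true]
    rw [Nat.cast_natAbs, abs_of_nonneg (not_lt.1 hq), h]

/-- Expresses positivity, needed for denominators, by a search through the digits, which bounded
formulas can perform. -/
theorem num_pos {t : Tree} (h : ∃ b ∈ t.toList, b ≠ nil) : 0 < t.num := by
  induction t with
  | nil => simp [toList] at h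
  | cons a b _ ih =>
    rw [num_eq]
    simp only [hd_cons, tl_cons]
    by_cases ha : a = nil
    · have := ih (by simpa [toList, ha] using h)
      omega
    · simp [digit, ha]

end Tree

open CQ

/-! ### The lines of a derivation -/

namespace Line

/-- `t ≤ u` -/
def le (t u : Tree) : Tree := Tree.cons Tree.nil (Tree.cons t u)

/-- `t < u` -/
def lt (t u : Tree) : Tree := Tree.cons (Tree.ofNat 1) (Tree.cons t u)

/-- `t ≠ u` -/
def ne (t u : Tree) : Tree := Tree.cons (Tree.ofNat 2) (Tree.cons t u)

/-- The substitution `γ` (a list of pairs) sends the list `l` to a list equal to `l'`. -/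
def matching (γ l l' : Tree) : Tree := Tree.cons (Tree.ofNat 3) (Tree.cons γ (Tree.cons l l'))

/-- `c + x + y = z` for a digit `c` and numbers `x`, `y`, `z` -/
def add (c x y z : Tree) : Tree :=
  Tree.cons (Tree.ofNat 4) (Tree.cons c (Tree.cons x (Tree.cons y z)))

/-- `x * y = z` -/
def mul (x y z : Tree) : Tree := Tree.cons (Tree.ofNat 5) (Tree.cons x (Tree.cons y z))

/-- The truth of a line if trees have the values `v`. -/
def Holds {D : Type*} [LinearOrder D] (v : Tree → D) (f : Tree) : Prop :=
  (∀ t u, f = le t u → v t ≤ v u) ∧ (∀ t u, f = lt t u → v t < v u) ∧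
  (∀ t u, f = ne t u → v t ≠ v u) ∧
  (∀ γ l l', f = matching γ l l' →
    ∀ w : Tree → D, (∀ r ∈ γ.toList, w r.hd = v r.tl) → l.toList.map w = l'.toList.map v) ∧
  (∀ c x y z, f = add c x y z → c.digit + x.num + y.num = z.num) ∧
  ∀ x y z, f = mul x y z → x.num * y.num = z.num

section

variable {D : Type*} [LinearOrder D] {v : Tree → D}

theorem ofNat_eq_nil {n : ℕ} : Tree.ofNat n = Tree.nil ↔ n = 0 :=
  Tree.ofNat_injective.eq_iff' rfl

theorem nil_eq_ofNat {n : ℕ} : Tree.nil = Tree.ofNat n ↔ n = 0 := by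
  rw [eq_comm, ofNat_eq_nil]

/-- The tags of the six kinds of lines differ, so all conjuncts but one are vacuous. The conjunctive
form of `Holds` gives a truth value to malformed lines as well. -/
theorem holds_le {t u : Tree} : Holds v (le t u) ↔ v t ≤ v u := by
  constructor
  · intro h
    exact h.1 t u rfl
  · intro h
    refine ⟨?_, ?_, ?_, ?_, ?_, ?_⟩ <;>
      simp +contextual [le, lt, ne, matching, add, mul, nil_eq_ofNat]
    exact h

theorem holds_lt {t u : Tree} : Holds v (lt t u) ↔ v t < v u := by
  constructor
  · intro h
    exact h.2.1 t u rfl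
  · intro h
    refine ⟨?_, ?_, ?_, ?_, ?_, ?_⟩ <;>
      simp +contextual [le, lt, ne, matching, add, mul, ofNat_eq_nil, Tree.ofNat_injective.eq_iff]
    exact h

theorem holds_ne {t u : Tree} : Holds v (ne t u) ↔ v t ≠ v u := by
  constructor
  · intro h
    exact h.2.2.1 t u rfl
  · intro h
    refine ⟨?_, ?_, ?_, ?_, ?_, ?_⟩ <;>
      simp +contextual [le, lt, ne, matching, add, mul, ofNat_eq_nil, Tree.ofNat_injective.eq_iff]
    exact fun e => h e

theorem holds_matching {γ l l' : Tree} : Holds v (matching γ l l') ↔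
    ∀ w : Tree → D, (∀ r ∈ γ.toList, w r.hd = v r.tl) → l.toList.map w = l'.toList.map v := by
  constructor
  · intro h
    exact h.2.2.2.1 γ l l' rfl
  · intro h
    refine ⟨?_, ?_, ?_, ?_, ?_, ?_⟩ <;>
      simp +contextual [le, lt, ne, matching, add, mul, ofNat_eq_nil, Tree.ofNat_injective.eq_iff]
    exact h

theorem holds_add {c x y z : Tree} : Holds v (add c x y z) ↔
    c.digit + x.num + y.num = z.num := by
  constructor
  · intro h
    exact h.2.2.2.2.1 c x y z rfl
  · intro h
    refine ⟨?_, ?_, ?_, ?_, ?_, ?_⟩ <;>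
      simp +contextual [le, lt, ne, matching, add, mul, ofNat_eq_nil, Tree.ofNat_injective.eq_iff]
    rintro _ _ _ _ rfl rfl rfl rfl
    exact h

theorem holds_mul {x y z : Tree} : Holds v (mul x y z) ↔ x.num * y.num = z.num := by
  constructor
  · intro h
    exact h.2.2.2.2.2 x y z rfl
  · intro h
    refine ⟨?_, ?_, ?_, ?_, ?_, ?_⟩ <;>
      simp +contextual [le, lt, ne, matching, add, mul, ofNat_eq_nil, Tree.ofNat_injective.eq_iff]
    exact h

end

/-! ### The rules -/

/-- The rules for the order relations. -/
def RuleOrder (f : Tree) (p : List Tree) : Prop :=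
  (f = le f.tl.hd f.tl.tl ∧ (f.tl.hd = f.tl.tl ∨ lt f.tl.hd f.tl.tl ∈ p ∨
    -- Quantifiers range over list entries only, so the middle term is read off from a line `g`.
    ∃ g ∈ p, le f.tl.hd g.tl.tl ∈ p ∧ le g.tl.tl f.tl.tl ∈ p)) ∨
  (f = lt f.tl.hd f.tl.tl ∧ ((le f.tl.hd f.tl.tl ∈ p ∧ ne f.tl.hd f.tl.tl ∈ p) ∨
    ∃ g ∈ p, (le f.tl.hd g.tl.tl ∈ p ∧ lt g.tl.tl f.tl.tl ∈ p) ∨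
      (lt f.tl.hd g.tl.tl ∈ p ∧ le g.tl.tl f.tl.tl ∈ p)))

/-- The line `f` follows from the comparison `l θ r`, where `k` is the code of `θ`. -/
def Asserts (k l r f : Tree) : Prop :=
  (k = CompOp.lt.encode ∧ f = lt l r) ∨ (k = CompOp.gt.encode ∧ f = lt r l) ∨
  (k = CompOp.le.encode ∧ f = le l r) ∨ (k = CompOp.ge.encode ∧ f = le r l) ∨
  (k = CompOp.eq.encode ∧ (f = le l r ∨ f = le r l)) ∨ (k = CompOp.ne.encode ∧ f = ne l r)

/-- The line `f` follows from the negation of the comparison `l θ r`, where `k` is the code of `θ`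
and `θ` is not the equality. -/
def Refutes (k l r f : Tree) : Prop :=
  (k = CompOp.lt.encode ∧ f = le r l) ∨ (k = CompOp.gt.encode ∧ f = le l r) ∨
  (k = CompOp.le.encode ∧ f = lt r l) ∨ (k = CompOp.ge.encode ∧ f = lt l r) ∨
  (k = CompOp.ne.encode ∧ (f = le l r ∨ f = le r l))

/-- The hypotheses: the comparisons of the contained query `q`. -/
def RuleHyp (q f : Tree) : Prop :=
  ∃ e ∈ q.tl.tl.toList, Asserts e.hd (Tree.cons Tree.nil e.tl.hd) e.tl.tl f

/-- Addition of binary numbers. -/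
def RuleAdd (f : Tree) (p : List Tree) : Prop :=
  f = add Tree.nil Tree.nil Tree.nil Tree.nil ∨
  (f = add f.tl.hd f.tl.tl.hd f.tl.tl.tl.hd f.tl.tl.tl.tl ∧
    ∃ g ∈ p, g = add g.tl.hd f.tl.tl.hd.tl f.tl.tl.tl.hd.tl f.tl.tl.tl.tl.tl ∧
      -- The digit of the sum is the exclusive or of the carry and the two digits, which for three
      -- arguments equals the iterated equivalence. The carry of `g` is their majority.
      (f.tl.tl.tl.tl.hd ≠ Tree.nil ↔
        (f.tl.hd ≠ Tree.nil ↔ (f.tl.tl.hd.hd ≠ Tree.nil ↔ f.tl.tl.tl.hd.hd ≠ Tree.nil))) ∧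
      (g.tl.hd ≠ Tree.nil ↔
        (f.tl.hd ≠ Tree.nil ∧ f.tl.tl.hd.hd ≠ Tree.nil) ∨
        (f.tl.hd ≠ Tree.nil ∧ f.tl.tl.tl.hd.hd ≠ Tree.nil) ∨
        (f.tl.tl.hd.hd ≠ Tree.nil ∧ f.tl.tl.tl.hd.hd ≠ Tree.nil)))

/-- Multiplication of binary numbers. -/
def RuleMul (f : Tree) (p : List Tree) : Prop :=
  f = mul Tree.nil f.tl.tl.hd Tree.nil ∨
  (f = mul f.tl.hd f.tl.tl.hd f.tl.tl.tl ∧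
    ∃ g ∈ p, g = mul f.tl.hd.tl f.tl.tl.hd g.tl.tl.tl ∧
      -- For `x = 2 * x' + b`, the line `g` gives `x' * y`; the product is its double, plus `y` if
      -- `b = 1`.
      ((f.tl.hd.hd = Tree.nil ∧ add Tree.nil g.tl.tl.tl g.tl.tl.tl f.tl.tl.tl ∈ p) ∨
       (f.tl.hd.hd ≠ Tree.nil ∧ ∃ a ∈ p, a = add Tree.nil g.tl.tl.tl g.tl.tl.tl a.tl.tl.tl.tl ∧
          add Tree.nil a.tl.tl.tl.tl f.tl.tl.hd f.tl.tl.tl ∈ p)))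

/-- Some lines of `p` show that `a * b < c * d`. -/
def MulLt (a b c d : Tree) (p : List Tree) : Prop :=
  ∃ g ∈ p, ∃ g' ∈ p, ∃ s ∈ p, g = mul a b g.tl.tl.tl ∧ g' = mul c d g'.tl.tl.tl ∧
    -- The carry digit 1 makes the inequality strict: `1 + a * b + d' = c * d` for some `d'`.
    s = add (Tree.cons Tree.nil Tree.nil) g.tl.tl.tl s.tl.tl.tl.hd g'.tl.tl.tl

/-- Comparison of two rational constants. -/
def RuleConst (f : Tree) (p : List Tree) : Prop :=
  f = lt f.tl.hd f.tl.tl ∧ f.tl.hd.hd ≠ Tree.nil ∧ f.tl.tl.hd ≠ Tree.nil ∧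
  (∃ b ∈ f.tl.hd.tl.tl.tl.toList, b ≠ Tree.nil) ∧ (∃ b ∈ f.tl.tl.tl.tl.tl.toList, b ≠ Tree.nil) ∧
  -- The nonzero numerator excludes a code for `-0`, which a certificate might contain.
  ((f.tl.hd.tl.hd ≠ Tree.nil ∧ f.tl.tl.tl.hd = Tree.nil ∧
      ∃ b ∈ f.tl.hd.tl.tl.hd.toList, b ≠ Tree.nil) ∨
   (f.tl.hd.tl.hd = Tree.nil ∧ f.tl.tl.tl.hd = Tree.nil ∧
      MulLt f.tl.hd.tl.tl.hd f.tl.tl.tl.tl.tl f.tl.tl.tl.tl.hd f.tl.hd.tl.tl.tl p) ∨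
   (f.tl.hd.tl.hd ≠ Tree.nil ∧ f.tl.tl.tl.hd ≠ Tree.nil ∧
      MulLt f.tl.tl.tl.tl.hd f.tl.hd.tl.tl.tl f.tl.hd.tl.tl.hd f.tl.tl.tl.tl.tl p))

/-- Matching of two lists under a substitution. -/
def RuleMatching (f : Tree) (p : List Tree) : Prop :=
  f = matching f.tl.hd f.tl.tl.hd f.tl.tl.tl ∧
  ((f.tl.tl.hd = Tree.nil ∧ f.tl.tl.tl = Tree.nil) ∨
   (f.tl.tl.hd ≠ Tree.nil ∧ f.tl.tl.tl ≠ Tree.nil ∧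
    matching f.tl.hd f.tl.tl.hd.tl f.tl.tl.tl.tl ∈ p ∧
    ∃ r ∈ f.tl.hd.toList, r.hd = f.tl.tl.hd.hd ∧ le r.tl f.tl.tl.tl.hd ∈ p ∧
      le f.tl.tl.tl.hd r.tl ∈ p))

/-- A containment mapping whose equations have been derived: the image of the remaining comparison
may be assumed to be false. -/
def RuleMapping (q₂ q₁ f : Tree) (p : List Tree) : Prop :=
  ∃ g ∈ p, g = matching g.tl.hd q₁.hd q₂.hd ∧
    (∀ r ∈ g.tl.hd.toList, ∀ r' ∈ g.tl.hd.toList, r.hd = r'.hd → r.tl = r'.tl) ∧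
    (∀ r ∈ g.tl.hd.toList, r.hd.hd ≠ Tree.nil → r.tl = r.hd) ∧
    (∀ a ∈ q₁.tl.hd.toList, ∃ b ∈ q₂.tl.hd.toList,
      a.hd = b.hd ∧ matching g.tl.hd a.tl b.tl ∈ p) ∧
    ∀ e ∈ q₁.tl.tl.toList, ∃ l ∈ g.tl.hd.toList, ∃ r ∈ g.tl.hd.toList,
      l.hd = Tree.cons Tree.nil e.tl.hd ∧ r.hd = e.tl.tl ∧
      ((e.hd = CompOp.eq.encode ∧ le l.tl r.tl ∈ p ∧ le r.tl l.tl ∈ p) ∨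
        Refutes e.hd l.tl r.tl f)

/-- The line `f` follows by one of the rules from the lines `p`, for the instance `w`. -/
def Justified (w f : Tree) (p : List Tree) : Prop :=
  RuleOrder f p ∨ RuleHyp w.hd f ∨ RuleAdd f p ∨ RuleMul f p ∨ RuleConst f p ∨
    RuleMatching f p ∨ RuleMapping w.hd w.tl f p

end Line

open Line

/-- The second component of `v` is a derivation of a contradiction for the instance that is the
first component. -/
def IsRefutation (v : Tree) : Prop :=
  (∀ s ∈ v.tl.suffixes, Justified v.hd s.hd s.tl.toList) ∧
  ∃ f ∈ v.tl.toList, f = lt f.tl.hd f.tl.hd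

/-- Needed for the tags of lines and the codes of comparison symbols. -/
theorem isTm_const (t : Tree) : IsTm fun _ => t := by
  induction t with
  | nil => exact IsTm.nil
  | cons a b iha ihb => exact iha.cons ihb

theorem checkable_isRefutation : Checkable IsRefutation := by
  unfold IsRefutation Justified RuleOrder RuleHyp RuleAdd RuleMul RuleConst RuleMatching
    RuleMapping MulLt Asserts Refutes le lt ne matching add mul
  repeat' first
    | exact IsTm.env
    | exact isTm_const _
    | apply IsTm.cons
    | apply IsTm.hd
    | apply IsTm.tl
    | apply Checkable.mem
    | apply Checkable.eq
    | apply Checkable.ne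
    | apply Checkable.and
    | apply Checkable.or
    | apply Checkable.iff
    | apply Checkable.exists_mem
    | apply Checkable.forall_mem
    | apply Checkable.forall_suffix
    | apply Checkable.imp

end CompModel

namespace CompModel

open CQ

/-! ### Soundness -/

theorem encode_compOp_inj {a b : CompOp} : a.encode = b.encode ↔ a = b := by
  cases a <;> cases b <;> simp [CompOp.encode, Tree.ofNat_injective.eq_iff]

/-- The relation that a comparison symbol stands for. -/
def _root_.CQ.CompOp.Rel {D : Type*} [LinearOrder D] (a b : D) : CompOp → Prop
  | CompOp.lt => a < b
  | CompOp.gt => a > b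
  | CompOp.le => a ≤ b
  | CompOp.ge => a ≥ b
  | CompOp.eq => a = b
  | CompOp.ne => a ≠ b

theorem _root_.CQ.Comparison.holds_iff {D : Type*} [LinearOrder D] (ι : ℚ ↪o D) (h : ℕ → D)
    (e : Comparison) : e.Holds ι h ↔ e.op.Rel (h e.lhs) (e.rhs.value ι h) := by
  obtain ⟨l, op, r⟩ := e
  cases op <;> rfl

/-- The value of a term that is given by its code. -/
noncomputable def codeValue {D : Type*} [LinearOrder D] (ι : ℚ ↪o D) (h : ℕ → D) : Tree → D
  | Tree.nil => h 0
  | Tree.cons Tree.nil n => h n.num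
  | Tree.cons (Tree.cons _ _) r => ι r.rat

theorem mem_toList_map {α : Type*} {enc : α → Tree} {l : List α} {t : Tree} :
    t ∈ (Tree.ofList (l.map enc)).toList ↔ ∃ a ∈ l, enc a = t := by
  simp

section

variable {D : Type*} [LinearOrder D] {ι : ℚ ↪o D} {h : ℕ → D} {f : Tree} {p : List Tree}

theorem codeValue_encode (t : Term) : codeValue ι h t.encode = t.value ι h := by
  cases t with
  | var x => simp [Term.encode, Tree.ofBool, codeValue, Term.value, Tree.num_ofNat]
  | const c => simp [Term.encode, Tree.ofBool, codeValue, Term.value, Tree.rat_ofRat]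

theorem codeValue_of_hd {t : Tree} (ht : t.hd ≠ Tree.nil) : codeValue ι h t = ι t.tl.rat := by
  match t with
  | Tree.nil => exact absurd rfl ht
  | Tree.cons Tree.nil _ => exact absurd rfl ht
  | Tree.cons (Tree.cons _ _) _ => rfl

namespace Line

theorem RuleOrder.sound {v : Tree → D} (hp : ∀ g ∈ p, Holds v g) (hf : RuleOrder f p) :
    Holds v f := by
  rcases hf with ⟨e, hf⟩ | ⟨e, hf⟩ <;> rw [e]
  · rw [holds_le]
    rcases hf with hf | hf | ⟨g, -, h1, h2⟩
    · rw [hf]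
    · exact (holds_lt.1 (hp _ hf)).le
    · exact (holds_le.1 (hp _ h1)).trans (holds_le.1 (hp _ h2))
  · rw [holds_lt]
    rcases hf with ⟨h1, h2⟩ | ⟨g, -, ⟨h1, h2⟩ | ⟨h1, h2⟩⟩
    · exact lt_of_le_of_ne (holds_le.1 (hp _ h1)) (holds_ne.1 (hp _ h2))
    · exact (holds_le.1 (hp _ h1)).trans_lt (holds_lt.1 (hp _ h2))
    · exact (holds_lt.1 (hp _ h1)).trans_le (holds_le.1 (hp _ h2))

theorem Asserts.sound {v : Tree → D} {op : CompOp} {l r : Tree} (hv : op.Rel (v l) (v r))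
    (hf : Asserts op.encode l r f) : Holds v f := by
  cases op <;> simp [Asserts, encode_compOp_inj] at hf
  · rw [hf]; exact holds_lt.2 hv
  · rw [hf]; exact holds_lt.2 hv
  · rw [hf]; exact holds_le.2 hv
  · rw [hf]; exact holds_le.2 hv
  · have hv' : v l = v r := hv
    rcases hf with rfl | rfl
    · exact holds_le.2 hv'.le
    · exact holds_le.2 hv'.ge
  · rw [hf]; exact holds_ne.2 hv

/-- Contrapositive form: if the derived line is false, the comparison it refutes is true. This turns
a false conclusion of `RuleMapping` into a successful mapping. -/
theorem Refutes.sound {v : Tree → D} {op : CompOp} {l r : Tree} (hv : ¬ Holds v f)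
    (hf : Refutes op.encode l r f) : op.Rel (v l) (v r) := by
  cases op <;> simp [Refutes, encode_compOp_inj] at hf
  · rw [hf, holds_le, not_le] at hv; exact hv
  · rw [hf, holds_le, not_le] at hv; exact hv
  · rw [hf, holds_lt, not_lt] at hv; exact hv
  · rw [hf, holds_lt, not_lt] at hv; exact hv
  · rcases hf with rfl | rfl
    · rw [holds_le, not_le] at hv; exact hv.ne'
    · rw [holds_le, not_le] at hv; exact hv.ne

theorem RuleHyp.sound {Q : CQAC} (hQ : Q.CompsHold ι h) (hf : RuleHyp Q.encode f) :
    Holds (codeValue ι h) f := by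
  obtain ⟨e, he, hf⟩ := hf
  obtain ⟨c, hc, rfl⟩ := mem_toList_map.1 he
  refine Asserts.sound (op := c.op) ?_ hf
  have := (c.holds_iff ι h).1 (hQ c hc)
  rw [← codeValue_encode, ← show codeValue ι h (Term.var c.lhs).encode = h c.lhs from
    codeValue_encode _] at this
  exact this

theorem RuleAdd.sound {v : Tree → D} (hp : ∀ g ∈ p, Holds v g) (hf : RuleAdd f p) :
    Holds v f := by
  rcases hf with rfl | ⟨e, g, hg, eg, h1, h2⟩
  · simp [holds_add, Tree.digit, Tree.num]
  · rw [e, holds_add]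
    have h3 := hp g hg
    rw [eg, holds_add] at h3
    rw [Tree.num_eq f.tl.tl.hd, Tree.num_eq f.tl.tl.tl.hd, Tree.num_eq f.tl.tl.tl.tl, ← h3]
    generalize f.tl.tl.tl.tl.hd = a at *
    generalize f.tl.hd = b at *
    generalize f.tl.tl.hd.hd = c at *
    generalize f.tl.tl.tl.hd.hd = d at *
    generalize g.tl.hd = k at *
    unfold Tree.digit
    by_cases ha : a = Tree.nil <;> by_cases hb : b = Tree.nil <;> by_cases hc : c = Tree.nil <;>
      by_cases hd : d = Tree.nil <;> by_cases hk : k = Tree.nil <;>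
      simp [ha, hb, hc, hd, hk] at h1 h2 ⊢ <;> omega

theorem RuleMul.sound {v : Tree → D} (hp : ∀ g ∈ p, Holds v g) (hf : RuleMul f p) :
    Holds v f := by
  rcases hf with e | ⟨e, g, hg, eg, hf⟩
  · rw [e]
    simp [holds_mul, Tree.num]
  · rw [e, holds_mul, Tree.num_eq f.tl.hd]
    have h3 := hp g hg
    rw [eg, holds_mul] at h3
    rcases hf with ⟨h0, h4⟩ | ⟨h0, a, ha, ea, h5⟩
    · have h4 := holds_add.1 (hp _ h4)
      simp only [h0, Tree.digit, if_true] at h4 ⊢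
      rw [← h4, ← h3]
      ring
    · have h4 := hp _ ha
      rw [ea] at h4
      have h4 := holds_add.1 h4
      have h5 := holds_add.1 (hp _ h5)
      simp only [h0, Tree.digit, if_true, if_false] at h4 h5 ⊢
      rw [← h5, ← h4, ← h3]
      ring

theorem MulLt.sound {v : Tree → D} {a b c d : Tree} (hp : ∀ g ∈ p, Holds v g)
    (hf : MulLt a b c d p) : a.num * b.num < c.num * d.num := by
  obtain ⟨g, hg, g', hg', s, hs, e, e', es⟩ := hf
  have h1 := hp g hg
  have h2 := hp g' hg'
  have h3 := hp s hs
  rw [e, holds_mul] at h1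
  rw [e', holds_mul] at h2
  rw [es, holds_add] at h3
  rw [h1, h2, ← h3]
  simp [Tree.digit]
  omega

theorem RuleConst.sound (hp : ∀ g ∈ p, Holds (codeValue ι h) g) (hf : RuleConst f p) :
    Holds (codeValue ι h) f := by
  obtain ⟨e, h1, h2, d1, d2, hf⟩ := hf
  rw [e, holds_lt, codeValue_of_hd h1, codeValue_of_hd h2, ι.lt_iff_lt]
  have d1 : (0 : ℚ) < f.tl.hd.tl.tl.tl.num := Nat.cast_pos.2 (Tree.num_pos d1)
  have d2 : (0 : ℚ) < f.tl.tl.tl.tl.tl.num := Nat.cast_pos.2 (Tree.num_pos d2)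
  unfold Tree.rat
  rw [div_lt_div_iff₀ d1 d2]
  rcases hf with ⟨s1, s2, h3⟩ | ⟨s1, s2, h3⟩ | ⟨s1, s2, h3⟩
  · have h3 : (0 : ℚ) < f.tl.hd.tl.tl.hd.num := Nat.cast_pos.2 (Tree.num_pos h3)
    rw [if_neg s1, if_pos s2]
    have h4 : (0 : ℚ) ≤ f.tl.tl.tl.tl.hd.num := Nat.cast_nonneg _
    nlinarith [mul_pos h3 d2, mul_nonneg h4 d1.le]
  · have := h3.sound hp
    rw [if_pos s1, if_pos s2]
    exact_mod_cast this
  · have := h3.sound hp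
    rw [if_neg s1, if_neg s2, neg_mul, neg_mul, neg_lt_neg_iff]
    exact_mod_cast this

theorem toList_eq_cons {t : Tree} (ht : t ≠ Tree.nil) : t.toList = t.hd :: t.tl.toList := by
  cases t with
  | nil => exact absurd rfl ht
  | cons a b => rfl

theorem RuleMatching.sound {v : Tree → D} (hp : ∀ g ∈ p, Holds v g) (hf : RuleMatching f p) :
    Holds v f := by
  obtain ⟨e, hf⟩ := hf
  rw [e, holds_matching]
  intro w hw
  rcases hf with ⟨h1, h2⟩ | ⟨h1, h2, h3, r, hr, hr1, h4, h5⟩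
  · rw [h1, h2]; rfl
  · rw [toList_eq_cons h1, toList_eq_cons h2, List.map_cons, List.map_cons,
      holds_matching.1 (hp _ h3) w hw, ← hr1, hw r hr,
      le_antisymm (holds_le.1 (hp _ h4)) (holds_le.1 (hp _ h5))]

/-- If the conclusion were false, the remaining comparison would be true under the substitution, and
together with the derived equations the mapping would satisfy all of `Q₁`, against the hypothesis
that all mappings fail. -/
theorem RuleMapping.sound {Q₂ Q₁ : CQAC} (hQ : ∀ μ : ContainmentMapping Q₁ Q₂, ¬ μ.CompsHold ι h)
    (hp : ∀ g ∈ p, Holds (codeValue ι h) g) (hf : RuleMapping Q₂.encode Q₁.encode f p) :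
    Holds (codeValue ι h) f := by
  classical
  by_contra hnf
  obtain ⟨g, hg, eg, fn, cst, hbody, hcomps⟩ := hf
  set γ := g.tl.hd
  set v := codeValue ι h with hv
  -- Well defined on the table because the table is functional. Outside it the default `v t` gives a
  -- constant missing from the table its own value.
  set w : Tree → D := fun t => if H : ∃ r ∈ γ.toList, r.hd = t then v H.choose.tl else v t with hw
  have hwγ : ∀ r ∈ γ.toList, w r.hd = v r.tl := by
    intro r hr
    have H : ∃ r' ∈ γ.toList, r'.hd = r.hd := ⟨r, hr, rfl⟩
    simp only [hw, dif_pos H]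
    rw [fn _ H.choose_spec.1 r hr H.choose_spec.2]
  set k : ℕ → D := fun x => w (Term.var x).encode with hk
  have hwk : ∀ t : Term, w t.encode = t.value ι k := by
    intro t
    cases t with
    | var x => rfl
    | const c =>
      by_cases H : ∃ r ∈ γ.toList, r.hd = (Term.const c).encode
      · obtain ⟨r, hr, er⟩ := H
        rw [← er, hwγ r hr, cst r hr (by rw [er]; simp [Term.encode, Tree.ofBool]), er, hv,
          codeValue_encode]
        rfl
      · simp only [hw, dif_neg H]
        rw [hv, codeValue_encode]
        rfl
  have hmatch : ∀ l l' : List Term,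
      matching γ (Tree.ofList (l.map Term.encode)) (Tree.ofList (l'.map Term.encode)) ∈ p →
      l.map (Term.value ι k) = l'.map (Term.value ι h) := by
    intro l l' hl
    have := holds_matching.1 (hp _ hl) w hwγ
    simpa [Function.comp_def, hwk, hv, codeValue_encode] using this
  have hb : ∀ i : Fin Q₁.body.length, ∃ j : Fin Q₂.body.length,
      (Q₁.body.get i).rel = (Q₂.body.get j).rel ∧
      (Q₁.body.get i).args.map (Term.value ι k) = (Q₂.body.get j).args.map (Term.value ι h) := by
    intro i
    obtain ⟨b, hb, e1, hm⟩ := hbody (Q₁.body.get i).encode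
      (mem_toList_map.2 ⟨_, List.get_mem _ i, rfl⟩)
    obtain ⟨B, hB, rfl⟩ := mem_toList_map.1 hb
    obtain ⟨j, rfl⟩ := List.get_of_mem hB
    exact ⟨j, Tree.ofNat_injective e1, hmatch _ _ hm⟩
  -- The matched subgoals define a mapping; equal arities follow from the equality of the argument
  -- lists.
  choose m hm1 hm2 using hb
  refine hQ ⟨m, hm1, fun i => by simpa using congrArg List.length (hm2 i)⟩
    ⟨k, ⟨hm2, hmatch _ _ (eg ▸ hg)⟩, fun e he => ?_⟩
  obtain ⟨l, hl, r, hr, el, er, H⟩ := hcomps e.encode (mem_toList_map.2 ⟨e, he, rfl⟩)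
  rw [e.holds_iff]
  have vl : v l.tl = k e.lhs := by
    rw [← hwγ l hl, el]; rfl
  have vr : v r.tl = e.rhs.value ι k := by
    rw [← hwγ r hr, er]; exact hwk e.rhs
  rw [← vl, ← vr]
  rcases H with ⟨h1, h2, h3⟩ | H
  · have h1 : e.op = CompOp.eq := encode_compOp_inj.1 h1
    rw [h1]
    exact le_antisymm (holds_le.1 (hp _ h2)) (holds_le.1 (hp _ h3))
  · exact H.sound hnf

theorem Justified.sound {Q₂ Q₁ : CQAC} (hQ₂ : Q₂.CompsHold ι h)
    (hQ : ∀ μ : ContainmentMapping Q₁ Q₂, ¬ μ.CompsHold ι h)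
    (hp : ∀ g ∈ p, Holds (codeValue ι h) g)
    (hf : Justified (Tree.cons Q₂.encode Q₁.encode) f p) : Holds (codeValue ι h) f := by
  rcases hf with hf | hf | hf | hf | hf | hf | hf
  · exact hf.sound hp
  · exact hf.sound hQ₂
  · exact hf.sound hp
  · exact hf.sound hp
  · exact hf.sound hp
  · exact hf.sound hp
  · exact hf.sound hQ hp

end Line

end

/-! ### Containment in terms of mappings -/

/-- For an assignment `h` satisfying `β₂`, the images of the subgoals of `Q₂` form a finite
canonical database. Containment on it yields an assignment for `Q₁` that sends each subgoal to the
image of one of `Q₂`; the mapping may depend on `h`. -/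
theorem _root_.CQ.contained_iff {D : Type*} [LinearOrder D] (ι : ℚ ↪o D) (Q₂ Q₁ : CQAC) :
    Contained ι Q₂ Q₁ ↔
      ∀ h, Q₂.CompsHold ι h → ∃ μ : ContainmentMapping Q₁ Q₂, μ.CompsHold ι h := by
  constructor
  · intro hc h hh
    set fact : Atom → ℕ × List D := fun a => (a.rel, a.args.map (Term.value ι h)) with hfact
    have hfin : {x | x ∈ Q₂.body.map fact}.Finite := List.finite_toSet _
    obtain ⟨g, hg, hcomps, hhead⟩ := hc _ hfin
      (show Q₂.head.map (Term.value ι h) ∈ _ from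
        ⟨h, fun a ha => List.mem_map.2 ⟨a, ha, rfl⟩, hh, rfl⟩)
    have hb : ∀ i : Fin Q₁.body.length, ∃ j : Fin Q₂.body.length,
        (Q₁.body.get i).rel = (Q₂.body.get j).rel ∧
        (Q₁.body.get i).args.map (Term.value ι g) =
          (Q₂.body.get j).args.map (Term.value ι h) := by
      intro i
      obtain ⟨b, hb, e⟩ := List.mem_map.1 (hg _ (List.get_mem _ i))
      obtain ⟨j, rfl⟩ := List.get_of_mem hb
      rw [hfact, Prod.mk.injEq] at e
      exact ⟨j, e.1.symm, e.2.symm⟩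
    choose m hm1 hm2 using hb
    exact ⟨⟨m, hm1, fun i => by simpa using congrArg List.length (hm2 i)⟩, g,
      ⟨hm2, hhead.symm⟩, hcomps⟩
  · rintro H I - _ ⟨h, hbody, hcomps, rfl⟩
    obtain ⟨μ, g, ⟨hm, hhead⟩, hg⟩ := H h hcomps
    refine ⟨g, fun a ha => ?_, hg, hhead.symm⟩
    obtain ⟨i, rfl⟩ := List.get_of_mem ha
    rw [μ.rel_eq, hm]
    exact hbody _ (List.get_mem _ _)

theorem contained_of_isRefutation {D : Type*} [LinearOrder D] (ι : ℚ ↪o D) {Q₂ Q₁ : CQAC}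
    {y : Tree} (hy : IsRefutation (Tree.cons (Tree.cons Q₂.encode Q₁.encode) y)) :
    Contained ι Q₂ Q₁ := by
  rw [contained_iff]
  intro h hh
  by_contra hno
  push Not at hno
  obtain ⟨hval, f, hf, ef⟩ := hy
  simp only [Tree.hd_cons, Tree.tl_cons] at hval hf
  -- Under a counterexample `h` every line is true, by induction from the end of the list, where the
  -- derivation starts.
  have : ∀ f ∈ y.toList, Line.Holds (codeValue ι h) f := by
    clear hf
    induction y with
    | nil => simp [Tree.toList]
    | cons a b _ ih =>
      have hb := ih fun s hs => hval s (List.mem_cons_of_mem _ hs)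
      intro f hf
      rcases List.mem_cons.1 hf with rfl | hf
      · exact (hval _ List.mem_cons_self).sound hh hno hb
      · exact hb f hf
  have := this f hf
  rw [ef, Line.holds_lt] at this
  exact lt_irrefl _ this

end CompModel

namespace CQ

open CompModel

/-! ### Facts and their models -/

/-- An order relation between two terms. -/
inductive Fact where
  | le : Term → Term → Fact
  | lt : Term → Term → Fact
  | ne : Term → Term → Fact

/-- The terms of a fact belong to a set. -/
def Fact.Over (T : Set Term) : Fact → Prop
  | le t u => t ∈ T ∧ u ∈ T
  | lt t u => t ∈ T ∧ u ∈ T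
  | ne t u => t ∈ T ∧ u ∈ T

/-- The truth of a fact under an assignment. -/
def Fact.Holds {D : Type*} [LinearOrder D] (ι : ℚ ↪o D) (h : ℕ → D) : Fact → Prop
  | le t u => t.value ι h ≤ u.value ι h
  | lt t u => t.value ι h < u.value ι h
  | ne t u => t.value ι h ≠ u.value ι h

/-- The facts that a comparison is equivalent to. -/
def CompOp.asserts (l r : Term) : CompOp → List Fact
  | lt => [Fact.lt l r]
  | gt => [Fact.lt r l]
  | le => [Fact.le l r]
  | ge => [Fact.le r l]
  | eq => [Fact.le l r, Fact.le r l]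
  | ne => [Fact.ne l r]

/-- The facts that the negation of a comparison other than an equation is equivalent to. -/
def CompOp.refutes (l r : Term) : CompOp → List Fact
  | lt => [Fact.le r l]
  | gt => [Fact.le l r]
  | le => [Fact.lt r l]
  | ge => [Fact.lt l r]
  | eq => []
  | ne => [Fact.le l r, Fact.le r l]

theorem CompOp.over_asserts {T : Set Term} {op : CompOp} {l r : Term} (hl : l ∈ T) (hr : r ∈ T) :
    ∀ f ∈ op.asserts l r, f.Over T := by
  cases op <;> simp [asserts, Fact.Over, hl, hr]

theorem CompOp.over_refutes {T : Set Term} {op : CompOp} {l r : Term} (hl : l ∈ T) (hr : r ∈ T) :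
    ∀ f ∈ op.refutes l r, f.Over T := by
  cases op <;> simp [refutes, Fact.Over, hl, hr]

theorem CompOp.rel_iff_asserts {D : Type*} [LinearOrder D] {ι : ℚ ↪o D} {h : ℕ → D} {op : CompOp}
    {l r : Term} : op.Rel (l.value ι h) (r.value ι h) ↔ ∀ f ∈ op.asserts l r, f.Holds ι h := by
  cases op <;> simp [asserts, Fact.Holds, Rel, le_antisymm_iff]

theorem CompOp.not_rel_iff_refutes {D : Type*} [LinearOrder D] {ι : ℚ ↪o D} {h : ℕ → D}
    {op : CompOp} {l r : Term} (hop : op ≠ eq) :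
    ¬ op.Rel (l.value ι h) (r.value ι h) ↔ ∀ f ∈ op.refutes l r, f.Holds ι h := by
  cases op <;> simp [refutes, Fact.Holds, Rel, le_antisymm_iff] at hop ⊢

/-- The set of facts is closed under consequences with terms of `T`, the comparisons of `Q`
included. -/
structure Closed (Q : CQAC) (T : Set Term) (F : Fact → Prop) : Prop where
  le_refl : ∀ t ∈ T, F (Fact.le t t)
  le_of_lt : ∀ t ∈ T, ∀ u ∈ T, F (Fact.lt t u) → F (Fact.le t u)
  le_trans : ∀ t ∈ T, ∀ u ∈ T, ∀ v ∈ T, F (Fact.le t u) → F (Fact.le u v) → F (Fact.le t v)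
  lt_of_lt_of_le : ∀ t ∈ T, ∀ u ∈ T, ∀ v ∈ T,
    F (Fact.lt t u) → F (Fact.le u v) → F (Fact.lt t v)
  lt_of_le_of_ne : ∀ t ∈ T, ∀ u ∈ T, F (Fact.le t u) → F (Fact.ne t u) → F (Fact.lt t u)
  lt_const : ∀ c d, Term.const c ∈ T → Term.const d ∈ T → c < d →
    F (Fact.lt (Term.const c) (Term.const d))
  comps : ∀ e ∈ Q.comps, ∀ f ∈ e.op.asserts (Term.var e.lhs) e.rhs, F f

/-- The function is monotone on `A` and identifies equivalent elements only. -/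
def IsFaithful {α : Type*} (r : α → α → Prop) (A : Finset α) (f : α → ℚ) : Prop :=
  ∀ a ∈ A, ∀ b ∈ A, (r a b → f a ≤ f b) ∧ (f a = f b → r a b)

open Classical in
-- An equivalent element of `A` dictates the value. Otherwise the used values split into those at
-- most `f u` for some `u` below `t` and the rest, and density of ℚ leaves room between the two
-- sets.
theorem IsFaithful.exists_insert {α : Type*} {r : α → α → Prop} {A : Finset α} {f : α → ℚ}
    (hf : IsFaithful r A f) {t : α} (ht : t ∉ A) (hrefl : r t t)
    (htrans : ∀ a ∈ insert t A, ∀ b ∈ insert t A, ∀ c ∈ insert t A, r a b → r b c → r a c) :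
    ∃ q, IsFaithful r (insert t A) (Function.update f t q) := by
  suffices H : ∃ q, ∀ b ∈ A, (r t b → q ≤ f b) ∧ (q = f b → r t b) ∧
      (r b t → f b ≤ q) ∧ (f b = q → r b t) by
    obtain ⟨q, hq⟩ := H
    refine ⟨q, fun a ha b hb => ?_⟩
    rcases Finset.mem_insert.1 ha with ea | ha' <;> rcases Finset.mem_insert.1 hb with eb | hb'
    · simp [ea, eb, hrefl]
    · have : b ≠ t := fun e => ht (e ▸ hb')
      rw [ea, Function.update_self, Function.update_of_ne this]
      exact ⟨(hq b hb').1, (hq b hb').2.1⟩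
    · have : a ≠ t := fun e => ht (e ▸ ha')
      rw [eb, Function.update_self, Function.update_of_ne this]
      exact ⟨(hq a ha').2.2.1, (hq a ha').2.2.2⟩
    · have h1 : a ≠ t := fun e => ht (e ▸ ha')
      have h2 : b ≠ t := fun e => ht (e ▸ hb')
      rw [Function.update_of_ne h1, Function.update_of_ne h2]
      exact hf a ha' b hb'
  have mt : t ∈ insert t A := Finset.mem_insert_self _ _
  have mA : ∀ {a}, a ∈ A → a ∈ insert t A := fun h => Finset.mem_insert_of_mem h
  by_cases hex : ∃ u ∈ A, r t u ∧ r u t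
  · obtain ⟨u, hu, h1, h2⟩ := hex
    refine ⟨f u, fun b hb => ⟨fun h => ?_, fun h => ?_, fun h => ?_, fun h => ?_⟩⟩
    · exact (hf u hu b hb).1 (htrans _ (mA hu) _ mt _ (mA hb) h2 h)
    · exact htrans _ mt _ (mA hu) _ (mA hb) h1 ((hf u hu b hb).2 h)
    · exact (hf b hb u hu).1 (htrans _ (mA hb) _ mt _ (mA hu) h h1)
    · exact htrans _ (mA hb) _ (mA hu) _ mt ((hf b hb u hu).2 h) h2
  · set lo := (A.image f).filter fun v => ∃ u ∈ A, r u t ∧ v ≤ f u with hlo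
    set hi := (A.image f).filter fun v => ¬ ∃ u ∈ A, r u t ∧ v ≤ f u with hhi
    obtain ⟨q, hq⟩ := Order.exists_between_finsets lo hi (by
      intro x hx y hy
      obtain ⟨-, u, hu, h1, h2⟩ := Finset.mem_filter.1 hx
      by_contra hle
      exact (Finset.mem_filter.1 hy).2 ⟨u, hu, h1, (not_lt.1 hle).trans h2⟩)
    have hmem : ∀ b ∈ A, f b ∈ lo ∨ f b ∈ hi := by
      intro b hb
      by_cases H : ∃ u ∈ A, r u t ∧ f b ≤ f u
      · exact Or.inl (Finset.mem_filter.2 ⟨Finset.mem_image_of_mem f hb, H⟩)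
      · exact Or.inr (Finset.mem_filter.2 ⟨Finset.mem_image_of_mem f hb, H⟩)
    have hne : ∀ b ∈ A, f b ≠ q := by
      intro b hb
      rcases hmem b hb with h | h
      · exact (hq.1 _ h).ne
      · exact (hq.2 _ h).ne'
    refine ⟨q, fun b hb => ⟨fun h => ?_, fun h => absurd h.symm (hne b hb), fun h => ?_,
      fun h => absurd h (hne b hb)⟩⟩
    · rcases hmem b hb with h' | h'
      -- From `u ≤ t ≤ b` and `f b ≤ f u` the values agree, so faithfulness gives `b ≤ u ≤ t` and
      -- `b` would be equivalent to `t`.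
      · obtain ⟨-, u, hu, h1, h2⟩ := Finset.mem_filter.1 h'
        have h3 := (hf u hu b hb).1 (htrans _ (mA hu) _ mt _ (mA hb) h1 h)
        have h4 := (hf b hb u hu).2 (le_antisymm h2 h3)
        exact absurd ⟨b, hb, h, htrans _ (mA hb) _ (mA hu) _ mt h4 h1⟩ hex
      · exact (hq.2 _ h').le
    · exact (hq.1 _ (Finset.mem_filter.2 ⟨Finset.mem_image_of_mem f hb, b, hb, h, le_rfl⟩)).le

open Classical in
theorem IsFaithful.exists_extension {α : Type*} {r : α → α → Prop} {A B : Finset α} {f : α → ℚ}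
    (hf : IsFaithful r A f) (hrefl : ∀ t ∈ A ∪ B, r t t)
    (htrans : ∀ a ∈ A ∪ B, ∀ b ∈ A ∪ B, ∀ c ∈ A ∪ B, r a b → r b c → r a c) :
    ∃ g, IsFaithful r (A ∪ B) g ∧ ∀ a ∈ A, g a = f a := by
  induction B using Finset.induction_on with
  | empty => exact ⟨f, by simpa using hf, fun _ _ => rfl⟩
  | insert t B _ ih =>
    rw [Finset.union_insert] at *
    have sub : ∀ {a}, a ∈ A ∪ B → a ∈ insert t (A ∪ B) := fun h => Finset.mem_insert_of_mem h
    obtain ⟨g, hg, hgf⟩ := ih (fun t ht => hrefl t (sub ht))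
      (fun a ha b hb c hc => htrans a (sub ha) b (sub hb) c (sub hc))
    by_cases ht : t ∈ A ∪ B
    · rw [Finset.insert_eq_of_mem ht]
      exact ⟨g, hg, hgf⟩
    · obtain ⟨q, hq⟩ := hg.exists_insert ht (hrefl t (Finset.mem_insert_self _ _)) htrans
      refine ⟨_, hq, fun a ha => ?_⟩
      rw [Function.update_of_ne, hgf a ha]
      rintro rfl
      exact ht (Finset.mem_union_left _ ha)

open Classical in
/-- A consistent closed set of facts has a model in which only those terms have equal values that
are provably equal. -/
theorem Closed.exists_model {D : Type*} [LinearOrder D] (ι : ℚ ↪o D) {Q : CQAC} {T : Finset Term}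
    {F : Fact → Prop} (hF : Closed Q T F)
    (hT : ∀ e ∈ Q.comps, Term.var e.lhs ∈ T ∧ e.rhs ∈ T)
    (hcons : ∀ t ∈ T, ¬ F (Fact.lt t t)) :
    ∃ h : ℕ → D, Q.CompsHold ι h ∧ (∀ f, f.Over T → F f → f.Holds ι h) ∧
      ∀ t ∈ T, ∀ u ∈ T, t.value ι h = u.value ι h → F (Fact.le t u) := by
  set r : Term → Term → Prop := fun t u => F (Fact.le t u) with hr
  set A : Finset Term := T.filter fun t => ∃ c, t = Term.const c with hA
  have hAT : A ∪ T = T := Finset.union_eq_right.2 (Finset.filter_subset _ _)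
  set f₀ : Term → ℚ := fun t => match t with
    | Term.var _ => 0
    | Term.const c => c with hf₀
  have hf : IsFaithful r A f₀ := by
    intro a ha b hb
    obtain ⟨ha, c, rfl⟩ := Finset.mem_filter.1 ha
    obtain ⟨hb, d, rfl⟩ := Finset.mem_filter.1 hb
    refine ⟨fun h => ?_, fun h => ?_⟩
    · by_contra hlt
      exact hcons _ hb (hF.lt_of_lt_of_le _ hb _ ha _ hb (hF.lt_const d c hb ha (not_le.1 hlt)) h)
    · have : c = d := h
      rw [this]
      exact hF.le_refl _ hb
  obtain ⟨g, hg, hgc⟩ := hf.exists_extension (B := T)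
    (by rw [hAT]; exact hF.le_refl)
    (by rw [hAT]; exact fun a ha b hb c hc => hF.le_trans a ha b hb c hc)
  rw [hAT] at hg
  set h : ℕ → D := fun x => ι (g (Term.var x)) with hh
  have hval : ∀ t ∈ T, t.value ι h = ι (g t) := by
    intro t ht
    cases t with
    | var x => rfl
    | const c => rw [hgc _ (Finset.mem_filter.2 ⟨ht, c, rfl⟩)]; rfl
  have hle : ∀ t ∈ T, ∀ u ∈ T, F (Fact.le t u) → g t ≤ g u :=
    fun t ht u hu H => (hg t ht u hu).1 H
  have hlt : ∀ t ∈ T, ∀ u ∈ T, F (Fact.lt t u) → g t < g u := by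
    intro t ht u hu H
    refine _root_.lt_of_le_of_ne (hle t ht u hu (hF.le_of_lt _ ht _ hu H)) fun e => ?_
    exact hcons t ht (hF.lt_of_lt_of_le _ ht _ hu _ ht H ((hg u hu t ht).2 e.symm))
  have hmodel : ∀ f : Fact, f.Over T → F f → f.Holds ι h := by
    rintro (⟨t, u⟩ | ⟨t, u⟩ | ⟨t, u⟩) ⟨ht, hu⟩ H
    · simp only [Fact.Holds, hval t ht, hval u hu, ι.le_iff_le]
      exact hle t ht u hu H
    · simp only [Fact.Holds, hval t ht, hval u hu, ι.lt_iff_lt]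
      exact hlt t ht u hu H
    · simp only [Fact.Holds, hval t ht, hval u hu, ne_eq, ι.eq_iff_eq]
      intro e
      exact (hlt t ht u hu (hF.lt_of_le_of_ne _ ht _ hu ((hg t ht u hu).2 e) H)).ne e
  refine ⟨h, fun e he => ?_, hmodel, fun t ht u hu e => ?_⟩
  · rw [e.holds_iff]
    obtain ⟨h1, h2⟩ := hT e he
    exact (CompOp.rel_iff_asserts (l := Term.var e.lhs)).2 fun f hf =>
      hmodel f (CompOp.over_asserts h1 h2 f hf) (hF.comps e he f hf)
  · rw [hval t ht, hval u hu, ι.eq_iff_eq] at e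
    exact (hg t ht u hu).2 e

/-! ### Applications of containment mappings -/

/-- The terms of a query. -/
def CQAC.terms (Q : CQAC) : List Term :=
  Q.head ++ Q.body.flatMap Atom.args ++ Q.comps.flatMap fun e => [Term.var e.lhs, e.rhs]

theorem CQAC.mem_terms_of_head {Q : CQAC} {t : Term} (h : t ∈ Q.head) : t ∈ Q.terms := by
  simp [terms, h]

theorem CQAC.mem_terms_of_body {Q : CQAC} {t : Term} {a : Atom} (ha : a ∈ Q.body)
    (h : t ∈ a.args) : t ∈ Q.terms := by
  simp only [terms, List.mem_append, List.mem_flatMap]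
  exact Or.inl (Or.inr ⟨a, ha, h⟩)

theorem CQAC.mem_terms_of_comps {Q : CQAC} {e : Comparison} (he : e ∈ Q.comps) :
    Term.var e.lhs ∈ Q.terms ∧ e.rhs ∈ Q.terms := by
  simp only [terms, List.mem_append, List.mem_flatMap]
  exact ⟨Or.inr ⟨e, he, by simp⟩, Or.inr ⟨e, he, by simp⟩⟩

theorem CQAC.occursIn_of_mem_terms {Q : CQAC} {x : ℕ} (h : Term.var x ∈ Q.terms) :
    OccursIn x Q.body := by
  simp only [terms, List.mem_append, List.mem_flatMap] at h
  rcases h with (h | ⟨a, ha, h⟩) | ⟨e, he, h⟩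
  · exact Q.head_safe x h
  · exact ⟨a, ha, h⟩
  · simp only [List.mem_cons, Term.var.injEq, List.not_mem_nil, or_false] at h
    rcases h with rfl | h
    · exact (Q.comps_safe e he).1
    · exact (Q.comps_safe e he).2 x h.symm

/-- Substitution of terms for the variables. -/
def Term.subst (γ : ℕ → Term) : Term → Term
  | var x => γ x
  | const c => const c

theorem Term.value_subst {D : Type*} [LinearOrder D] {ι : ℚ ↪o D} {γ : ℕ → Term} {h : ℕ → D}
    (t : Term) : (t.subst γ).value ι h = t.value ι fun x => (γ x).value ι h := by
  cases t <;> rfl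

/-- The terms are provably equal. -/
def ProvEq (F : Fact → Prop) (t u : Term) : Prop := F (Fact.le t u) ∧ F (Fact.le u t)

/-- The substitution `γ` represents the mapping `μ`, whose equations are provable, and the fact `f`
follows from the negation of the image of the remaining comparison. -/
structure Applicable {Q₁ Q₂ : CQAC} (F : Fact → Prop) (μ : ContainmentMapping Q₁ Q₂)
    (γ : ℕ → Term) (f : Fact) : Prop where
  body : ∀ i, List.Forall₂ (fun t u => ProvEq F (t.subst γ) u) (Q₁.body.get i).args
    (Q₂.body.get (μ.toFun i)).args
  head : List.Forall₂ (fun t u => ProvEq F (t.subst γ) u) Q₁.head Q₂.head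
  comps : ∀ e ∈ Q₁.comps, (e.op = CompOp.eq ∧ ProvEq F (γ e.lhs) (e.rhs.subst γ)) ∨
    f ∈ e.op.refutes (γ e.lhs) (e.rhs.subst γ)

theorem Comparison.isEquation_iff {e : Comparison} : e.isEquation = true ↔ e.op = CompOp.eq := by
  obtain ⟨l, op, r⟩ := e
  cases op <;> simp [isEquation]

section

variable {D : Type*} [LinearOrder D] {ι : ℚ ↪o D} {Q₁ Q₂ : CQAC} {F : Fact → Prop}

theorem Applicable.sound {μ : ContainmentMapping Q₁ Q₂} {γ : ℕ → Term} {f : Fact}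
    (H : Applicable F μ γ f) {h : ℕ → D} (hF : ∀ f, F f → f.Holds ι h) :
    μ.EquationsHold ι h ∧ (¬ f.Holds ι h → μ.CompsHold ι h) := by
  set g : ℕ → D := fun x => (γ x).value ι h with hg
  have heq : ∀ t u, ProvEq F t u → t.value ι h = u.value ι h :=
    fun t u H => le_antisymm (hF _ H.1) (hF _ H.2)
  have hmap : ∀ l l' : List Term, List.Forall₂ (fun t u => ProvEq F (t.subst γ) u) l l' →
      l.map (Term.value ι g) = l'.map (Term.value ι h) := by
    intro l l' hl
    induction hl with
    | nil => rfl
    | cons h1 _ ih =>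
      rw [List.map_cons, List.map_cons, ih, ← heq _ _ h1, Term.value_subst]
  have hm : μ.Matches ι h g := ⟨fun i => hmap _ _ (H.body i), hmap _ _ H.head⟩
  have heqn : ∀ e ∈ Q₁.comps, e.op = CompOp.eq → e.Holds ι g := by
    intro e he hop
    rcases H.comps e he with ⟨-, h1⟩ | h1
    · rw [e.holds_iff, hop]
      have := heq _ _ h1
      rw [Term.value_subst] at this
      exact this
    · rw [hop] at h1
      simp [CompOp.refutes] at h1
  refine ⟨⟨g, hm, fun e he hop => heqn e he (Comparison.isEquation_iff.1 hop)⟩,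
    fun hf => ⟨g, hm, fun e he => ?_⟩⟩
  by_cases hop : e.op = CompOp.eq
  · exact heqn e he hop
  · rcases H.comps e he with ⟨h1, -⟩ | h1
    · exact absurd h1 hop
    · rw [e.holds_iff]
      by_contra hn
      have : ¬ e.op.Rel ((γ e.lhs).value ι h) ((e.rhs.subst γ).value ι h) := by
        rwa [Term.value_subst]
      exact hf ((CompOp.not_rel_iff_refutes hop).1 this f h1)

theorem ContainmentMapping.Matches.exists_subst {μ : ContainmentMapping Q₁ Q₂} {h g : ℕ → D}
    (hm : μ.Matches ι h g) : ∃ γ : ℕ → Term, ∀ t ∈ Q₁.terms,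
      (t.subst γ).value ι h = t.value ι g ∧ (t.subst γ ∈ Q₂.terms ∨ t.subst γ = t) := by
  classical
  have hx : ∀ x, ∃ u : Term, OccursIn x Q₁.body → u.value ι h = g x ∧ u ∈ Q₂.terms := by
    intro x
    by_cases hx : OccursIn x Q₁.body
    · obtain ⟨a, ha, hax⟩ := hx
      obtain ⟨i, rfl⟩ := List.get_of_mem ha
      obtain ⟨j, hj, ej⟩ := List.getElem_of_mem hax
      have hj' : j < (Q₂.body.get (μ.toFun i)).args.length := by rwa [← μ.arity_eq]
      refine ⟨(Q₂.body.get (μ.toFun i)).args[j], fun _ => ⟨?_,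
        CQAC.mem_terms_of_body (List.get_mem _ _) (List.getElem_mem _)⟩⟩
      have := congrArg (fun l => l[j]?) (hm.1 i)
      simp only [List.getElem?_map, List.getElem?_eq_getElem hj, List.getElem?_eq_getElem hj',
        Option.map_some, Option.some.injEq, ej] at this
      exact this.symm
    · exact ⟨Term.var 0, fun h => absurd h hx⟩
  choose γ hγ using hx
  refine ⟨γ, fun t ht => ?_⟩
  cases t with
  | var x =>
    obtain ⟨h1, h2⟩ := hγ x (CQAC.occursIn_of_mem_terms ht)
    exact ⟨h1, Or.inl h2⟩
  | const c => exact ⟨rfl, Or.inr rfl⟩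

/-- If `Q₂` is contained in `Q₁`, some containment mapping is applicable to a consistent closed set
of facts and yields a new fact. -/
theorem Closed.exists_applicable (hc : Contained ι Q₂ Q₁) (h1 : Q₁.HasOneAC) {T : Finset Term}
    (hF : Closed Q₂ T F) (hT₁ : ∀ t ∈ Q₁.terms, t ∈ T) (hT₂ : ∀ t ∈ Q₂.terms, t ∈ T)
    (hcons : ∀ t ∈ T, ¬ F (Fact.lt t t)) :
    ∃ (μ : ContainmentMapping Q₁ Q₂) (γ : ℕ → Term) (f : Fact), Applicable F μ γ f ∧
      (∀ t ∈ Q₁.terms, t.subst γ ∈ T) ∧ f.Over T ∧ ¬ F f := by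
  obtain ⟨h, hh, hmodel, hinj⟩ := hF.exists_model ι
    (fun e he => ⟨hT₂ _ (CQAC.mem_terms_of_comps he).1, hT₂ _ (CQAC.mem_terms_of_comps he).2⟩)
    hcons
  obtain ⟨μ, g, hm, hg⟩ := (contained_iff ι Q₂ Q₁).1 hc h hh
  obtain ⟨γ, hγ⟩ := hm.exists_subst
  have hγT : ∀ t ∈ Q₁.terms, t.subst γ ∈ T := by
    intro t ht
    rcases (hγ t ht).2 with H | H
    · exact hT₂ _ H
    · rw [H]; exact hT₁ t ht
  have hprov : ∀ t ∈ T, ∀ u ∈ T, t.value ι h = u.value ι h → ProvEq F t u :=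
    fun t ht u hu e => ⟨hinj t ht u hu e, hinj u hu t ht e.symm⟩
  have hall : ∀ l l' : List Term, (∀ t ∈ l, t ∈ Q₁.terms) → (∀ t ∈ l', t ∈ Q₂.terms) →
      l.map (Term.value ι g) = l'.map (Term.value ι h) →
      List.Forall₂ (fun t u => ProvEq F (t.subst γ) u) l l' := by
    intro l
    induction l with
    | nil =>
      intro l' _ _ e
      rw [List.map_nil, eq_comm, List.map_eq_nil_iff] at e
      rw [e]
      exact List.Forall₂.nil
    | cons t l ih =>
      intro l' hl hl' e
      cases l' with
      | nil => simp at e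
      | cons u l' =>
        simp only [List.map_cons, List.cons.injEq] at e
        have ht := hl t List.mem_cons_self
        refine List.Forall₂.cons (hprov _ (hγT t ht) _ (hT₂ _ (hl' u List.mem_cons_self)) ?_)
          (ih l' (fun t ht => hl t (List.mem_cons_of_mem _ ht))
            (fun t ht => hl' t (List.mem_cons_of_mem _ ht)) e.2)
        rw [(hγ t ht).1, e.1]
  obtain ⟨e₀, he₀⟩ := List.length_eq_one_iff.1 h1
  have hmem₀ : e₀ ∈ Q₁.comps ∧ e₀.op ≠ CompOp.eq := by
    have : e₀ ∈ Q₁.comps.filter fun e => !e.isEquation := by rw [he₀]; simp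
    rw [List.mem_filter] at this
    refine ⟨this.1, fun hop => ?_⟩
    simp [Comparison.isEquation_iff.2 hop] at this
  have hrel : ∀ e ∈ Q₁.comps, e.op.Rel ((γ e.lhs).value ι h) ((e.rhs.subst γ).value ι h) := by
    intro e he
    have h2 := (e.holds_iff ι g).1 (hg e he)
    obtain ⟨hl, hr⟩ := CQAC.mem_terms_of_comps he
    rw [(hγ _ hr).1, show (γ e.lhs).value ι h = g e.lhs from (hγ _ hl).1]
    exact h2
  have hnew := mt (CompOp.not_rel_iff_refutes hmem₀.2).2 (not_not.2 (hrel e₀ hmem₀.1))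
  push Not at hnew
  obtain ⟨f, hf, hfh⟩ := hnew
  have hover : f.Over T := CompOp.over_refutes
    (hγT _ (CQAC.mem_terms_of_comps hmem₀.1).1) (hγT _ (CQAC.mem_terms_of_comps hmem₀.1).2) f hf
  refine ⟨μ, γ, f, ⟨fun i => ?_, ?_, fun e he => ?_⟩, hγT, hover,
    fun H => hfh (hmodel f hover H)⟩
  · exact hall _ _ (fun t ht => CQAC.mem_terms_of_body (List.get_mem _ _) ht)
      (fun t ht => CQAC.mem_terms_of_body (List.get_mem _ _) ht) (hm.1 i)
  · exact hall _ _ (fun t => CQAC.mem_terms_of_head) (fun t => CQAC.mem_terms_of_head) hm.2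
  · by_cases hop : e.op = CompOp.eq
    · have h2 := hrel e he
      rw [hop] at h2
      obtain ⟨hl, hr⟩ := CQAC.mem_terms_of_comps he
      exact Or.inl ⟨hop, hprov _ (hγT _ hl) _ (hγT _ hr) h2⟩
    · have : e ∈ Q₁.comps.filter fun e => !e.isEquation := by
        rw [List.mem_filter]
        refine ⟨he, ?_⟩
        rw [Bool.not_eq_true', Bool.eq_false_iff]
        exact fun H => hop (Comparison.isEquation_iff.1 H)
      rw [he₀, List.mem_singleton] at this
      rw [this]
      exact Or.inr hf

end

open Classical in
theorem exists_finset_facts (T : Finset Term) :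
    ∃ S : Finset Fact, (∀ f, f.Over T → f ∈ S) ∧ S.card ≤ 3 * T.card ^ 2 := by
  refine ⟨(T ×ˢ T).image (fun x => Fact.le x.1 x.2) ∪ (T ×ˢ T).image (fun x => Fact.lt x.1 x.2) ∪
    (T ×ˢ T).image (fun x => Fact.ne x.1 x.2), ?_, ?_⟩
  · rintro (⟨t, u⟩ | ⟨t, u⟩ | ⟨t, u⟩) ⟨ht, hu⟩ <;>
      simp [Finset.mem_coe.1 ht, Finset.mem_coe.1 hu]
  · have h : (T ×ˢ T).card = T.card ^ 2 := by rw [Finset.card_product, sq]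
    refine (Finset.card_union_le _ _).trans ?_
    refine (Nat.add_le_add ((Finset.card_union_le _ _).trans
      (Nat.add_le_add Finset.card_image_le Finset.card_image_le)) Finset.card_image_le).trans ?_
    omega

/-! ### Certifying lists of mappings -/

section

variable {D : Type*} [LinearOrder D] {ι : ℚ ↪o D} {Q₁ Q₂ : CQAC}

/-- The facts that follow from the comparisons of `Q₂` and the failure of the mappings of a list. -/
def Entails (ι : ℚ ↪o D) (L : List (ContainmentMapping Q₁ Q₂)) (f : Fact) : Prop :=
  ∀ h : ℕ → D, Q₂.CompsHold ι h → (∀ μ ∈ L, ¬ μ.CompsHold ι h) → f.Holds ι h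

theorem closed_entails (L : List (ContainmentMapping Q₁ Q₂)) (T : Set Term) :
    Closed Q₂ T (Entails ι L) where
  le_refl _ _ _ _ _ := le_rfl
  le_of_lt _ _ _ _ H h h1 h2 := le_of_lt (H h h1 h2)
  le_trans _ _ _ _ _ _ H H' h h1 h2 := le_trans (H h h1 h2) (H' h h1 h2)
  lt_of_lt_of_le _ _ _ _ _ _ H H' h h1 h2 := lt_of_lt_of_le (H h h1 h2) (H' h h1 h2)
  lt_of_le_of_ne _ _ _ _ H H' h h1 h2 := lt_of_le_of_ne (H h h1 h2) (H' h h1 h2)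
  lt_const _ _ _ _ H _ _ _ := ι.lt_iff_lt.2 H
  comps e he f hf h h1 _ :=
    (CompOp.rel_iff_asserts (l := Term.var e.lhs)).1 ((e.holds_iff ι h).1 (h1 e he)) f hf

/-- Each mapping of the list has equations that follow from the failure of the preceding ones. -/
def IsOrdered (ι : ℚ ↪o D) (L : List (ContainmentMapping Q₁ Q₂)) : Prop :=
  ∀ j : Fin L.length, ∀ h : ℕ → D, Q₂.CompsHold ι h →
    (∀ i : Fin L.length, i < j → ¬ (L.get i).CompsHold ι h) → (L.get j).EquationsHold ι h

theorem IsOrdered.append {L : List (ContainmentMapping Q₁ Q₂)} (hL : IsOrdered ι L)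
    {μ : ContainmentMapping Q₁ Q₂}
    (hμ : ∀ h, Q₂.CompsHold ι h → (∀ ν ∈ L, ¬ ν.CompsHold ι h) → μ.EquationsHold ι h) :
    IsOrdered ι (L ++ [μ]) := by
  rintro ⟨j, hj⟩ h hh hlt
  have hlt' : ∀ (i : ℕ) (hi : i < L.length), i < j → ¬ (L.get ⟨i, hi⟩).CompsHold ι h := by
    intro i hi hij
    have := hlt ⟨i, by rw [List.length_append]; omega⟩ hij
    rwa [List.get_eq_getElem, List.getElem_append_left hi] at this
  by_cases hj' : j < L.length
  · rw [List.get_eq_getElem, List.getElem_append_left hj']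
    exact hL ⟨j, hj'⟩ h hh fun i hi => hlt' i i.2 hi
  · have hj'' : j = L.length := by simp at hj; omega
    subst hj''
    rw [List.get_eq_getElem, List.getElem_concat_length rfl]
    refine hμ h hh fun ν hν => ?_
    obtain ⟨i, rfl⟩ := List.get_of_mem hν
    exact hlt' i i.2 i.2

open Classical in
theorem IsOrdered.exists_certifies (hc : Contained ι Q₂ Q₁) (h1 : Q₁.HasOneAC) {T : Finset Term}
    (hT₁ : ∀ t ∈ Q₁.terms, t ∈ T) (hT₂ : ∀ t ∈ Q₂.terms, t ∈ T) {S : Finset Fact}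
    (hS : ∀ f, f.Over T → f ∈ S) (n : ℕ) {L : List (ContainmentMapping Q₁ Q₂)}
    (hL : IsOrdered ι L) (hn : (S.filter fun f => ¬ Entails ι L f).card ≤ n) :
    ∃ L' : List (ContainmentMapping Q₁ Q₂), L'.length ≤ L.length + n ∧ Certifies ι L' := by
  induction n generalizing L with
  | zero =>
    refine ⟨L, le_rfl, hL, fun h hh => ?_⟩
    by_contra hno
    push Not at hno
    have hall : ∀ f, f.Over T → Entails ι L f := by
      intro f hf
      by_contra hne
      have : f ∈ S.filter fun f => ¬ Entails ι L f := Finset.mem_filter.2 ⟨hS f hf, hne⟩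
      rw [Finset.card_eq_zero.1 (Nat.le_zero.1 hn)] at this
      simp at this
    by_cases hcons : ∀ t ∈ T, ¬ Entails ι L (Fact.lt t t)
    · obtain ⟨_, _, f, _, _, hf, hnf⟩ :=
        (closed_entails L T).exists_applicable hc h1 hT₁ hT₂ hcons
      exact hnf (hall f hf)
    · push Not at hcons
      obtain ⟨t, _, ht⟩ := hcons
      exact lt_irrefl _ (ht h hh hno)
  | succ n ih =>
    by_cases hcons : ∀ t ∈ T, ¬ Entails ι L (Fact.lt t t)
    · obtain ⟨μ, γ, f, happ, -, hf, hnf⟩ :=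
        (closed_entails L T).exists_applicable hc h1 hT₁ hT₂ hcons
      have hsound : ∀ h, Q₂.CompsHold ι h → (∀ ν ∈ L, ¬ ν.CompsHold ι h) →
          μ.EquationsHold ι h ∧ (¬ f.Holds ι h → μ.CompsHold ι h) :=
        fun h hh hno => happ.sound fun f hf => hf h hh hno
      have hmono : ∀ f, Entails ι L f → Entails ι (L ++ [μ]) f :=
        fun f hf h hh hno => hf h hh fun ν hν => hno ν (List.mem_append_left _ hν)
      have hnew : Entails ι (L ++ [μ]) f := by
        intro h hh hno
        by_contra hfh
        exact hno μ (by simp)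
          ((hsound h hh fun ν hν => hno ν (List.mem_append_left _ hν)).2 hfh)
      have hlt : (S.filter fun f => ¬ Entails ι (L ++ [μ]) f).card <
          (S.filter fun f => ¬ Entails ι L f).card := by
        refine Finset.card_lt_card (Finset.ssubset_iff_of_subset ?_ |>.2 ⟨f, ?_, ?_⟩)
        · exact Finset.monotone_filter_right _ fun f _ hf hf' => hf (hmono f hf')
        · exact Finset.mem_filter.2 ⟨hS f hf, hnf⟩
        · exact fun H => (Finset.mem_filter.1 H).2 hnew
      obtain ⟨L', hlen, hL'⟩ := ih (hL.append fun h hh hno => (hsound h hh hno).1) (by omega)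
      refine ⟨L', ?_, hL'⟩
      simp only [List.length_append, List.length_singleton] at hlen
      omega
    · push Not at hcons
      obtain ⟨t, _, ht⟩ := hcons
      refine ⟨L, by omega, hL, fun h hh => ?_⟩
      by_contra hno
      push Not at hno
      exact lt_irrefl _ (ht h hh hno)

theorem Certifies.contained {L : List (ContainmentMapping Q₁ Q₂)} (hL : Certifies ι L) :
    Contained ι Q₂ Q₁ :=
  (contained_iff ι Q₂ Q₁).2 fun h hh => let ⟨μ, _, hμ⟩ := hL.2 h hh; ⟨μ, hμ⟩

end

end CQ

namespace CompModel

open CQ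

/-! ### Sizes of codes -/

namespace Tree

theorem size_ofBool_le (b : Bool) : (ofBool b).size ≤ 3 := by
  cases b <;> simp [ofBool, size]

theorem hd_ofNat (n : ℕ) : (ofNat n).hd = ofBool (decide (n % 2 = 1)) := by
  induction n using Nat.binaryRec' with
  | zero => simp [ofNat, ofList, ofBool]
  | bit b n h _ =>
    rw [ofNat, Nat.bits_append_bit n b h]
    cases b <;> simp [ofList, Nat.bit]

theorem tl_ofNat (n : ℕ) : (ofNat n).tl = ofNat (n / 2) := by
  induction n using Nat.binaryRec' with
  | zero => simp [ofNat, ofList]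
  | bit b n h _ =>
    rw [ofNat, Nat.bits_append_bit n b h]
    have : Nat.bit b n / 2 = n := by cases b <;> simp [Nat.bit]; omega
    rw [this]
    simp [ofList, ofNat]

theorem size_le_hd_tl (t : Tree) : t.size ≤ t.hd.size + t.tl.size + 1 := by
  cases t <;> simp [size]

theorem size_ofNat_le {k : ℕ} : ∀ {n : ℕ}, n < 2 ^ k → (ofNat n).size ≤ 4 * k + 1 := by
  induction k with
  | zero =>
    intro n hn
    obtain rfl : n = 0 := by simpa using hn
    simp [ofNat, ofList, size]
  | succ k ih =>
    intro n hn
    have h1 := (ofNat n).size_le_hd_tl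
    rw [hd_ofNat, tl_ofNat] at h1
    have h2 := size_ofBool_le (decide (n % 2 = 1))
    have h3 := ih (n := n / 2) (by rw [pow_succ] at hn; omega)
    omega

theorem num_lt_two_pow (t : Tree) : t.num < 2 ^ t.size := by
  induction t with
  | nil => simp [num]
  | cons a b _ ih =>
    rw [num_eq]
    have h : a.digit ≤ 1 := by unfold digit; split_ifs <;> omega
    have h2 : 2 ^ (b.size + 1) ≤ 2 ^ (cons a b).size :=
      Nat.pow_le_pow_right (by omega) (by simp only [size]; omega)
    rw [pow_succ] at h2
    simp only [hd_cons, tl_cons]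
    omega

theorem exists_ne_nil {t : Tree} (h : 0 < t.num) : ∃ b ∈ t.toList, b ≠ nil := by
  induction t with
  | nil => simp [num] at h
  | cons a b _ ih =>
    by_cases ha : a = nil
    · rw [num_eq] at h
      simp only [hd_cons, tl_cons, ha, digit, if_true] at h
      obtain ⟨c, hc, hc'⟩ := ih (by omega)
      exact ⟨c, List.mem_cons_of_mem _ hc, hc'⟩
    · exact ⟨a, List.mem_cons_self, ha⟩

theorem size_le_size_ofList {l : List Tree} {t : Tree} (h : t ∈ l) :
    t.size ≤ (ofList l).size := by
  induction l with
  | nil => simp at h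
  | cons a l ih =>
    simp only [ofList, size]
    rcases List.mem_cons.1 h with rfl | h
    · omega
    · have := ih h; omega

theorem length_le_size_ofList (l : List Tree) : l.length ≤ (ofList l).size := by
  induction l with
  | nil => simp
  | cons a l ih => simp only [ofList, size, List.length_cons]; omega

theorem size_ofList_le {l : List Tree} {m : ℕ} (h : ∀ t ∈ l, t.size ≤ m) :
    (ofList l).size ≤ l.length * (m + 1) + 1 := by
  induction l with
  | nil => simp [ofList, size]
  | cons a l ih =>
    have h1 := h a List.mem_cons_self
    have h2 := ih fun t ht => h t (List.mem_cons_of_mem _ ht)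
    simp only [ofList, size, List.length_cons]
    nlinarith

end Tree

theorem size_atom_le {Q : CQAC} {a : Atom} (ha : a ∈ Q.body) : a.encode.size ≤ Q.encode.size := by
  have := Tree.size_le_size_ofList (List.mem_map_of_mem (f := Atom.encode) ha)
  simp only [CQAC.encode, Tree.size]
  omega

theorem size_args_le {Q : CQAC} {a : Atom} (ha : a ∈ Q.body) :
    (Tree.ofList (a.args.map Term.encode)).size ≤ Q.encode.size := by
  have := size_atom_le ha
  simp only [Atom.encode, Tree.size] at this
  omega

theorem size_head_le (Q : CQAC) :
    (Tree.ofList (Q.head.map Term.encode)).size ≤ Q.encode.size := by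
  simp only [CQAC.encode, Tree.size]
  omega

theorem length_body_le (Q : CQAC) : Q.body.length ≤ Q.encode.size := by
  have := Tree.length_le_size_ofList (Q.body.map Atom.encode)
  simp only [CQAC.encode, Tree.size, List.length_map] at this ⊢
  omega

theorem size_term_le {Q : CQAC} {t : Term} (ht : t ∈ Q.terms) : t.encode.size ≤ Q.encode.size := by
  simp only [CQAC.terms, List.mem_append, List.mem_flatMap] at ht
  rcases ht with (ht | ⟨a, ha, ht⟩) | ⟨e, he, ht⟩
  · exact (Tree.size_le_size_ofList (List.mem_map_of_mem ht)).trans (size_head_le Q)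
  · exact (Tree.size_le_size_ofList (List.mem_map_of_mem ht)).trans (size_args_le ha)
  · have h1 := Tree.size_le_size_ofList (List.mem_map_of_mem (f := Comparison.encode) he)
    have h2 := e.op.encode.size_pos
    have h3 := e.rhs.encode.size_pos
    have h4 := (Tree.ofNat e.lhs).size_pos
    simp only [Comparison.encode, CQAC.encode, Tree.size] at h1 ⊢
    simp only [List.mem_cons, List.not_mem_nil, or_false] at ht
    rcases ht with rfl | rfl
    · simp only [Term.encode, Tree.ofBool, Tree.size] at h1 ⊢
      omega
    · omega

theorem length_terms_le (Q : CQAC) : Q.terms.length ≤ Q.encode.size := by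
  have h1 := Tree.length_le_size_ofList (Q.head.map Term.encode)
  have h2 : ∀ l : List Atom, (l.flatMap Atom.args).length ≤
      (Tree.ofList (l.map Atom.encode)).size := by
    intro l
    induction l with
    | nil => simp
    | cons a l ih =>
      have := Tree.length_le_size_ofList (a.args.map Term.encode)
      simp only [List.length_map, List.flatMap_cons, List.length_append, List.map_cons,
        Tree.ofList, Tree.size, Atom.encode] at this ⊢
      omega
  have h3 : ∀ l : List Comparison,
      (l.flatMap fun e => [Term.var e.lhs, e.rhs]).length ≤
      (Tree.ofList (l.map Comparison.encode)).size := by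
    intro l
    induction l with
    | nil => simp
    | cons e l ih =>
      simp only [List.flatMap_cons, List.length_append, List.map_cons,
        Tree.ofList, Tree.size, Comparison.encode, List.length_cons, List.length_nil] at ih ⊢
      omega
  have h2 := h2 Q.body
  have h3 := h3 Q.comps
  simp only [CQAC.terms, CQAC.encode, Tree.size, List.length_append, List.length_map] at h1 ⊢
  omega

/-! ### Derivations of bounded size -/

namespace Line

/-- Every line is justified by the lines after it. -/
def Derivation (w : Tree) : List Tree → Prop
  | [] => True
  | f :: p => Justified w f p ∧ Derivation w p

theorem Derivation.forall_suffixes {w : Tree} {p : List Tree} (hp : Derivation w p) :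
    ∀ s ∈ (Tree.ofList p).suffixes, Justified w s.hd s.tl.toList := by
  induction p with
  | nil => simp [Tree.ofList, Tree.suffixes]
  | cons f p ih =>
    intro s hs
    rcases List.mem_cons.1 hs with rfl | hs
    · simpa using hp.1
    · exact ih hp.2 s hs

/-- The derivation `p` can be extended at a cost of at most `B` so as to contain the lines `G`. -/
def Reaches (w : Tree) (B : ℕ) (p G : List Tree) : Prop :=
  ∃ p', Derivation w p' ∧ p ⊆ p' ∧ G ⊆ p' ∧ (Tree.ofList p').size ≤ (Tree.ofList p).size + B

section

variable {w f g : Tree} {p G G' : List Tree} {B B' : ℕ}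

theorem Reaches.of_justified (hp : Derivation w p) (hf : Justified w f p) (hB : f.size + 1 ≤ B) :
    Reaches w B p [f] :=
  ⟨f :: p, ⟨hf, hp⟩, List.subset_cons_self _ _, by simp,
    by simp only [Tree.ofList, Tree.size]; omega⟩

theorem Reaches.mono (h : Reaches w B p G) (hB : B ≤ B') : Reaches w B' p G := by
  obtain ⟨p', h1, h2, h3, h4⟩ := h
  exact ⟨p', h1, h2, h3, by omega⟩

theorem Reaches.bind (h : Reaches w B p G)
    (h' : ∀ p', Derivation w p' → p ⊆ p' → G ⊆ p' → Reaches w B' p' G') :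
    Reaches w (B + B') p G' := by
  obtain ⟨p', h1, h2, h3, h4⟩ := h
  obtain ⟨p'', h5, h6, h7, h8⟩ := h' p' h1 h2 h3
  exact ⟨p'', h5, List.Subset.trans h2 h6, h7, by omega⟩

theorem Reaches.list (hp : Derivation w p)
    (h : ∀ g ∈ G, ∀ p', Derivation w p' → p ⊆ p' → Reaches w B p' [g]) :
    Reaches w (G.length * B) p G := by
  induction G with
  | nil => exact ⟨p, hp, List.Subset.refl _, by simp, by simp⟩
  | cons g G ih =>
    obtain ⟨p', h1, h2, h3, h4⟩ := ih fun g hg => h g (List.mem_cons_of_mem _ hg)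
    obtain ⟨p'', h5, h6, h7, h8⟩ := h g List.mem_cons_self p' h1 h2
    refine ⟨p'', h5, List.Subset.trans h2 h6, ?_, ?_⟩
    · rw [List.cons_subset]
      exact ⟨h7 (by simp), List.Subset.trans h3 h6⟩
    · rw [List.length_cons, Nat.succ_mul]; omega

end

/-! ### Arithmetic -/

section

variable {w : Tree} {p : List Tree} {K : ℕ}

theorem size_add_le {c : Bool} {x y z : ℕ} (hx : x < 2 ^ K) (hy : y < 2 ^ K) (hz : z < 2 ^ K) :
    (add (Tree.ofBool c) (Tree.ofNat x) (Tree.ofNat y) (Tree.ofNat z)).size + 1 ≤ 12 * K + 24 := by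
  have h1 := Tree.size_ofNat_le hx
  have h2 := Tree.size_ofNat_le hy
  have h3 := Tree.size_ofNat_le hz
  have h4 := Tree.size_ofNat_le (k := 3) (n := 4) (by norm_num)
  have h5 := Tree.size_ofBool_le c
  simp only [add, Tree.size]
  omega

theorem size_mul_le {x y z : ℕ} (hx : x < 2 ^ K) (hy : y < 2 ^ K) (hz : z < 2 ^ K) :
    (mul (Tree.ofNat x) (Tree.ofNat y) (Tree.ofNat z)).size + 1 ≤ 12 * K + 24 := by
  have h1 := Tree.size_ofNat_le hx
  have h2 := Tree.size_ofNat_le hy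
  have h3 := Tree.size_ofNat_le hz
  have h4 := Tree.size_ofNat_le (k := 3) (n := 5) (by norm_num)
  simp only [mul, Tree.size]
  omega

theorem reaches_add {k : ℕ} (hk : k ≤ K) {c : Bool} {n m : ℕ} (h : n + m + c.toNat < 2 ^ k)
    (hp : Derivation w p) : Reaches w ((k + 1) * (12 * K + 24)) p
      [add (Tree.ofBool c) (Tree.ofNat n) (Tree.ofNat m) (Tree.ofNat (n + m + c.toNat))] := by
  induction k generalizing c n m with
  | zero =>
    obtain ⟨⟨rfl, rfl⟩, hc⟩ : (n = 0 ∧ m = 0) ∧ c.toNat = 0 := by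
      rw [pow_zero] at h; omega
    cases c with
    | true => simp at hc
    | false =>
      refine Reaches.of_justified hp (Or.inr (Or.inr (Or.inl (Or.inl rfl)))) ?_
      have := size_add_le (K := K) (c := false) (x := 0) (y := 0) (z := 0) (by simp) (by simp)
        (by simp)
      simpa using this
  | succ k ih =>
    have hc : c.toNat ≤ 1 := Bool.toNat_le c
    set c' : Bool := decide (2 ≤ n % 2 + m % 2 + c.toNat) with hc'
    have hsum : n / 2 + m / 2 + c'.toNat = (n + m + c.toNat) / 2 := by
      by_cases H : 2 ≤ n % 2 + m % 2 + c.toNat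
      · simp only [hc', H, decide_true, Bool.toNat_true]; omega
      · simp only [hc', H, decide_false, Bool.toNat_false]; omega
    have hlt : n / 2 + m / 2 + c'.toNat < 2 ^ k := by
      rw [hsum]; rw [pow_succ] at h; omega
    have hK : 2 ^ (k + 1) ≤ 2 ^ K := Nat.pow_le_pow_right (by omega) hk
    refine ((ih (by omega) hlt).bind (B' := 12 * K + 24) fun p' hp' _ hg => ?_).mono
      (by rw [Nat.succ_mul (k + 1)])
    refine Reaches.of_justified hp' (Or.inr (Or.inr (Or.inl (Or.inr
      ⟨rfl, _, hg List.mem_cons_self, ?_⟩))))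
      (size_add_le (by omega) (by omega) (by omega))
    rw [hsum]
    simp only [add, Tree.tl_cons, Tree.hd_cons, Tree.tl_ofNat, Tree.hd_ofNat, true_and,
      Tree.ofBool_ne_nil, decide_eq_true_eq, hc']
    cases c <;> rcases Nat.mod_two_eq_zero_or_one n with h1 | h1 <;>
      rcases Nat.mod_two_eq_zero_or_one m with h2 | h2 <;>
      simp [h1, h2] <;> omega

theorem reaches_mul {k : ℕ} (hk : k ≤ K) {n m : ℕ} (hn : n < 2 ^ k) (hm : m < 2 ^ K)
    (h : n * m < 2 ^ K) (hp : Derivation w p) :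
    Reaches w ((k + 1) * (2 * ((K + 1) * (12 * K + 24)) + (12 * K + 24))) p
      [mul (Tree.ofNat n) (Tree.ofNat m) (Tree.ofNat (n * m))] := by
  induction k generalizing n with
  | zero =>
    obtain rfl : n = 0 := by simpa using hn
    rw [zero_mul]
    refine (Reaches.of_justified hp (Or.inr (Or.inr (Or.inr (Or.inl (Or.inl rfl)))))
      (size_mul_le (by positivity) hm (by positivity))).mono (by omega)
  | succ k ih =>
    have hK : 2 ^ (k + 1) ≤ 2 ^ K := Nat.pow_le_pow_right (by omega) hk
    have hdiv := Nat.div_add_mod n 2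
    have hle : n / 2 * m + n / 2 * m ≤ n * m := by
      calc n / 2 * m + n / 2 * m = 2 * (n / 2) * m := by ring
        _ ≤ n * m := Nat.mul_le_mul_right _ (by omega)
    have hlt : n / 2 < 2 ^ k := by rw [pow_succ] at hn; omega
    refine ((ih (by omega) hlt (by omega)).bind
      (B' := 2 * ((K + 1) * (12 * K + 24)) + (12 * K + 24)) fun p₁ hp₁ _ hg₁ => ?_).mono
      (by rw [Nat.succ_mul (k + 1)])
    have r := reaches_add (K := K) le_rfl (c := false) (n := n / 2 * m) (m := n / 2 * m)
      (by simpa using hle.trans_lt h) hp₁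
    rcases Nat.mod_two_eq_zero_or_one n with h0 | h1
    · have e : n / 2 * m + n / 2 * m = n * m := by
        calc n / 2 * m + n / 2 * m = (2 * (n / 2)) * m := by ring
          _ = n * m := by rw [show 2 * (n / 2) = n by omega]
      refine (r.bind (B' := 12 * K + 24) fun p₂ hp₂ hsub hg₂ => ?_).mono (by omega)
      refine Reaches.of_justified hp₂ (Or.inr (Or.inr (Or.inr (Or.inl (Or.inr ⟨rfl, _,
        hsub (hg₁ List.mem_cons_self), ?_, Or.inl ⟨?_, ?_⟩⟩))))) (size_mul_le (by omega) hm h)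
      · simp [mul, Tree.tl_ofNat]
      · simp [mul, Tree.hd_ofNat, h0, Tree.ofBool]
      · simpa [e, Tree.ofBool, mul] using hg₂
    · have e : n / 2 * m + n / 2 * m + m = n * m := by
        calc n / 2 * m + n / 2 * m + m = (2 * (n / 2) + 1) * m := by ring
          _ = n * m := by rw [show 2 * (n / 2) + 1 = n by omega]
      refine (r.bind (B' := (K + 1) * (12 * K + 24) + (12 * K + 24))
        fun p₂ hp₂ hsub hg₂ => ?_).mono (by omega)
      refine (reaches_add (K := K) le_rfl (c := false) (n := n / 2 * m + n / 2 * m) (m := m)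
        (by simpa [e] using h) hp₂).bind fun p₃ hp₃ hsub₃ hg₃ => ?_
      refine Reaches.of_justified hp₃ (Or.inr (Or.inr (Or.inr (Or.inl (Or.inr ⟨rfl, _,
        hsub₃ (hsub (hg₁ List.mem_cons_self)), ?_, Or.inr ⟨?_, _,
        hsub₃ (hg₂ List.mem_cons_self), ?_, ?_⟩⟩)))))
        (size_mul_le (by omega) hm h)
      · simp [mul, Tree.tl_ofNat]
      · simp [mul, Tree.hd_ofNat, h1, Tree.ofBool]
      · simp [mul, add, Tree.ofBool]
      · simpa [e, Tree.ofBool, mul, add] using hg₃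

/-- A bound for the cost of comparing two products of numbers with at most `K` digits. -/
def mulLtBound (K : ℕ) : ℕ :=
  2 * ((K + 1) * (2 * ((K + 1) * (12 * K + 24)) + (12 * K + 24))) + (K + 1) * (12 * K + 24)

theorem reaches_mulLt {N a b c d : ℕ} (ha : a < 2 ^ N) (hb : b < 2 ^ N) (hc : c < 2 ^ N)
    (hd : d < 2 ^ N) (h : a * b < c * d) (hp : Derivation w p) {G : List Tree} {B : ℕ}
    (hG : ∀ p', Derivation w p' → p ⊆ p' →
      MulLt (Tree.ofNat a) (Tree.ofNat b) (Tree.ofNat c) (Tree.ofNat d) p' → Reaches w B p' G) :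
    Reaches w (mulLtBound (2 * N) + B) p G := by
  have hN : 2 ^ N ≤ 2 ^ (2 * N) := Nat.pow_le_pow_right (by omega) (by omega)
  have hmul : ∀ {x y : ℕ}, x < 2 ^ N → y < 2 ^ N → x * y < 2 ^ (2 * N) := by
    intro x y hx hy
    rw [two_mul, pow_add]
    exact Nat.mul_lt_mul'' hx hy
  have e : a * b + (c * d - a * b - 1) + true.toNat = c * d := by
    rw [Bool.toNat_true]; omega
  refine ((reaches_mul le_rfl (ha.trans_le hN) (hb.trans_le hN) (hmul ha hb) hp).bind
    fun p₁ hp₁ hs₁ hg₁ => (reaches_mul le_rfl (hc.trans_le hN) (hd.trans_le hN)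
      (hmul hc hd) hp₁).bind fun p₂ hp₂ hs₂ hg₂ =>
    (reaches_add le_rfl (c := true) (by rw [e]; exact hmul hc hd) hp₂).bind
      fun p₃ hp₃ hs₃ hg₃ => hG p₃ hp₃ (List.Subset.trans hs₁ (List.Subset.trans hs₂ hs₃)) ?_).mono
    (by unfold mulLtBound; omega)
  rw [e] at hg₃
  exact ⟨_, hs₃ (hs₂ (hg₁ List.mem_cons_self)), _, hs₃ (hg₂ List.mem_cons_self), _,
    hg₃ List.mem_cons_self, rfl, rfl, rfl⟩

theorem reaches_const {N : ℕ} {c d : ℚ} (h : c < d) (hc : (Term.const c).encode.size ≤ N)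
    (hd : (Term.const d).encode.size ≤ N) (hp : Derivation w p) :
    Reaches w (mulLtBound (2 * N) + (2 * N + 20)) p
      [lt (Term.const c).encode (Term.const d).encode] := by
  have hbound : ∀ q : ℚ, (Term.const q).encode.size ≤ N →
      q.num.natAbs < 2 ^ N ∧ q.den < 2 ^ N := by
    intro q hq
    simp only [Term.encode, Tree.ofRat, Tree.size] at hq
    have h1 := Tree.num_lt_two_pow (Tree.ofNat q.num.natAbs)
    have h2 := Tree.num_lt_two_pow (Tree.ofNat q.den)
    rw [Tree.num_ofNat] at h1 h2
    exact ⟨h1.trans_le (Nat.pow_le_pow_right (by omega) (by omega)),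
      h2.trans_le (Nat.pow_le_pow_right (by omega) (by omega))⟩
  have hpos : ∀ n : ℕ, 0 < n → ∃ b ∈ (Tree.ofNat n).toList, b ≠ Tree.nil :=
    fun n hn => Tree.exists_ne_nil (by rwa [Tree.num_ofNat])
  obtain ⟨hc1, hc2⟩ := hbound c hc
  obtain ⟨hd1, hd2⟩ := hbound d hd
  have hsz : (lt (Term.const c).encode (Term.const d).encode).size + 1 ≤ 2 * N + 20 := by
    have := Tree.size_ofNat_le (k := 1) (n := 1) (by norm_num)
    simp only [lt, Tree.size]
    omega
  have fin : ∀ p', Derivation w p' →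
      ((c.num < 0 ∧ ¬ d.num < 0) ∨
       (¬ c.num < 0 ∧ ¬ d.num < 0 ∧ MulLt (Tree.ofNat c.num.natAbs) (Tree.ofNat d.den)
          (Tree.ofNat d.num.natAbs) (Tree.ofNat c.den) p') ∨
       (c.num < 0 ∧ d.num < 0 ∧ MulLt (Tree.ofNat d.num.natAbs) (Tree.ofNat c.den)
          (Tree.ofNat c.num.natAbs) (Tree.ofNat d.den) p')) →
      Reaches w (2 * N + 20) p' [lt (Term.const c).encode (Term.const d).encode] := by
    intro p' hp' H
    refine Reaches.of_justified hp' (Or.inr (Or.inr (Or.inr (Or.inr (Or.inl ⟨rfl, ?_, ?_,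
      hpos _ c.den_pos, hpos _ d.den_pos, ?_⟩))))) hsz
    · simp [lt, Term.encode, Tree.ofBool]
    · simp [lt, Term.encode, Tree.ofBool]
    · simp only [lt, Term.encode, Tree.ofRat, Tree.tl_cons, Tree.hd_cons, ne_eq]
      rcases H with ⟨h1, h2⟩ | ⟨h1, h2, H⟩ | ⟨h1, h2, H⟩
      · exact Or.inl ⟨by simp [h1, Tree.ofBool], by simp [h2, Tree.ofBool],
          hpos _ (by omega)⟩
      · exact Or.inr (Or.inl ⟨by simp [h1, Tree.ofBool], by simp [h2, Tree.ofBool], H⟩)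
      · exact Or.inr (Or.inr ⟨by simp [h1, Tree.ofBool], by simp [h2, Tree.ofBool], H⟩)
  have hcd := Rat.lt_iff c d |>.1 h
  by_cases h1 : c.num < 0 <;> by_cases h2 : d.num < 0
  · refine reaches_mulLt hd1 hc2 hc1 hd2 ?_ hp fun p' hp' _ H =>
      fin p' hp' (Or.inr (Or.inr ⟨h1, h2, H⟩))
    zify
    rw [abs_of_neg h1, abs_of_neg h2]
    linarith
  · exact (fin p hp (Or.inl ⟨h1, h2⟩)).mono (by omega)
  · have := c.den_pos
    have := d.den_pos
    nlinarith [mul_nonneg (not_lt.1 h1) (Int.natCast_nonneg d.den),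
      mul_neg_of_neg_of_pos h2 (Int.natCast_pos.2 c.den_pos)]
  · refine reaches_mulLt hc1 hd2 hd1 hc2 ?_ hp fun p' hp' _ H =>
      fin p' hp' (Or.inr (Or.inl ⟨h1, h2, H⟩))
    zify
    rw [abs_of_nonneg (not_lt.1 h1), abs_of_nonneg (not_lt.1 h2)]
    linarith

end

end Line

end CompModel

open CompModel in
/-- The line of a derivation that states a fact. -/
def CQ.Fact.encode : CQ.Fact → CompModel.Tree
  | CQ.Fact.le t u => Line.le t.encode u.encode
  | CQ.Fact.lt t u => Line.lt t.encode u.encode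
  | CQ.Fact.ne t u => Line.ne t.encode u.encode

namespace CompModel

open CQ

/-! ### Completeness -/

theorem size_fact_le {N : ℕ} {T : Set Term} (hT : ∀ t ∈ T, t.encode.size ≤ N) {f : Fact}
    (hf : f.Over T) : f.encode.size + 1 ≤ 2 * N + 20 := by
  have h1 := Tree.size_ofNat_le (k := 1) (n := 1) (by norm_num)
  have h2 := Tree.size_ofNat_le (k := 2) (n := 2) (by norm_num)
  rcases f with ⟨t, u⟩ | ⟨t, u⟩ | ⟨t, u⟩ <;> have h3 := hT t hf.1 <;> have h4 := hT u hf.2 <;>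
    simp only [Fact.encode, Line.le, Line.lt, Line.ne, Tree.size] <;> omega

/-- A substitution as a list of pairs. -/
def encodeSubst (T : List Term) (γ : ℕ → Term) : Tree :=
  Tree.ofList (T.map fun t => Tree.cons t.encode (t.subst γ).encode)

theorem encode_injective : Function.Injective Term.encode := by
  intro t u h
  cases t <;> cases u <;> simp [Term.encode, Tree.ofBool] at h
  · rw [Tree.ofNat_injective h]
  · rename_i c d
    have := congrArg Tree.rat h
    rw [Tree.rat_ofRat, Tree.rat_ofRat] at this
    rw [this]

theorem mem_encodeSubst {T : List Term} {γ : ℕ → Term} {r : Tree} :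
    r ∈ (encodeSubst T γ).toList ↔
      ∃ t ∈ T, Tree.cons t.encode (t.subst γ).encode = r := by
  simp [encodeSubst]

theorem size_encodeSubst_le {N : ℕ} {T : List Term} {γ : ℕ → Term} (hT : T.length ≤ N)
    (h : ∀ t ∈ T, t.encode.size ≤ N ∧ (t.subst γ).encode.size ≤ N) :
    (encodeSubst T γ).size ≤ N * (2 * N + 2) + 1 := by
  refine (Tree.size_ofList_le (m := 2 * N + 1) ?_).trans ?_
  · intro t ht
    obtain ⟨u, hu, rfl⟩ := List.mem_map.1 ht
    have := h u hu
    simp only [Tree.size]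
    omega
  · rw [List.length_map]
    exact Nat.add_le_add_right (Nat.mul_le_mul_right (2 * N + 2) hT) 1

theorem asserts_encode {op : CompOp} {l r : Term} {f : Fact} (hf : f ∈ op.asserts l r) :
    Line.Asserts op.encode l.encode r.encode f.encode := by
  cases op <;> simp [CompOp.asserts] at hf
  case eq => rcases hf with rfl | rfl <;> simp [Line.Asserts, encode_compOp_inj, Fact.encode]
  all_goals subst hf; simp [Line.Asserts, encode_compOp_inj, Fact.encode]

theorem refutes_encode {op : CompOp} {l r : Term} {f : Fact} (hf : f ∈ op.refutes l r) :
    Line.Refutes op.encode l.encode r.encode f.encode := by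
  cases op <;> simp [CompOp.refutes] at hf
  case ne => rcases hf with rfl | rfl <;> simp [Line.Refutes, encode_compOp_inj, Fact.encode]
  all_goals subst hf; simp [Line.Refutes, encode_compOp_inj, Fact.encode]

namespace Line

/-- The facts that are stated by the lines of a derivation. -/
def Proves (p : List Tree) (f : Fact) : Prop := f.encode ∈ p

section

variable {w : Tree} {p : List Tree} {N M : ℕ}

theorem reaches_matching {T : List Term} {γ : ℕ → Term} {l l' : List Term}
    (h : List.Forall₂ (fun t u => ProvEq (Proves p) (t.subst γ) u) l l') (hl : ∀ t ∈ l, t ∈ T)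
    (hM : (encodeSubst T γ).size + (Tree.ofList (l.map Term.encode)).size +
      (Tree.ofList (l'.map Term.encode)).size + 20 ≤ M) (hp : Derivation w p) :
    Reaches w ((l.length + 1) * M) p [matching (encodeSubst T γ)
      (Tree.ofList (l.map Term.encode)) (Tree.ofList (l'.map Term.encode))] := by
  have h3 := Tree.size_ofNat_le (k := 2) (n := 3) (by norm_num)
  induction h with
  | nil =>
    refine Reaches.of_justified hp (Or.inr (Or.inr (Or.inr (Or.inr (Or.inr (Or.inl
      ⟨rfl, Or.inl ⟨rfl, rfl⟩⟩)))))) ?_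
    simp only [matching, Tree.size, List.length_nil] at hM ⊢
    omega
  | @cons t u l l' h1 _ ih =>
    have hM' := hM
    simp only [List.map_cons, Tree.ofList, Tree.size] at hM'
    refine ((ih (fun t ht => hl t (List.mem_cons_of_mem _ ht)) (by omega)).bind (B' := M)
      fun p' hp' hsub hg => ?_).mono (by rw [List.length_cons, Nat.succ_mul (l.length + 1)])
    refine Reaches.of_justified hp' (Or.inr (Or.inr (Or.inr (Or.inr (Or.inr (Or.inl
      ⟨rfl, Or.inr ⟨?_, ?_, hg List.mem_cons_self, Tree.cons t.encode (t.subst γ).encode,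
        mem_encodeSubst.2 ⟨t, hl t List.mem_cons_self, rfl⟩, rfl, hsub h1.1, hsub h1.2⟩⟩)))))) ?_
    · simp [matching, Tree.ofList]
    · simp [matching, Tree.ofList]
    · simp only [matching, Tree.size] at hM ⊢
      omega

/-- A bound for the cost of applying a containment mapping. -/
def mappingBound (N : ℕ) : ℕ :=
  (N + 1) * (2 * N ^ 2 + 4 * N + 30) + N * ((N + 1) * (2 * N ^ 2 + 4 * N + 30)) + (2 * N + 20)

theorem reaches_mapping {Q₁ Q₂ : CQAC} {μ : ContainmentMapping Q₁ Q₂} {γ : ℕ → Term} {f : Fact}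
    {T : Set Term} (happ : Applicable (Proves p) μ γ f) (hγ : ∀ t ∈ Q₁.terms, t.subst γ ∈ T)
    (hT : ∀ t ∈ T, t.encode.size ≤ N) (hf : f.Over T) (h₁ : Q₁.encode.size ≤ N)
    (h₂ : Q₂.encode.size ≤ N) (hp : Derivation (Tree.cons Q₂.encode Q₁.encode) p) :
    Reaches (Tree.cons Q₂.encode Q₁.encode) (mappingBound N) p [f.encode] := by
  have hsz : (encodeSubst Q₁.terms γ).size ≤ N * (2 * N + 2) + 1 :=
    size_encodeSubst_le ((length_terms_le Q₁).trans h₁) fun t ht =>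
      ⟨(size_term_le ht).trans h₁, hT _ (hγ t ht)⟩
  have hM : N * (2 * N + 2) + 1 + N + N + 20 ≤ 2 * N ^ 2 + 4 * N + 30 := by nlinarith
  have hlen : ∀ l : List Term, (Tree.ofList (l.map Term.encode)).size ≤ N →
      (l.length + 1) * (2 * N ^ 2 + 4 * N + 30) ≤ (N + 1) * (2 * N ^ 2 + 4 * N + 30) := by
    intro l hl
    have := Tree.length_le_size_ofList (l.map Term.encode)
    rw [List.length_map] at this
    exact Nat.mul_le_mul_right _ (by omega)
  have hmono : ∀ {p'} {l l' : List Term}, p ⊆ p' →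
      List.Forall₂ (fun t u => ProvEq (Proves p) (t.subst γ) u) l l' →
      List.Forall₂ (fun t u => ProvEq (Proves p') (t.subst γ) u) l l' :=
    fun hsub h => h.imp fun _ _ H => ⟨hsub H.1, hsub H.2⟩
  have hhead := reaches_matching (T := Q₁.terms) happ.head
    (fun t ht => CQAC.mem_terms_of_head ht) (M := 2 * N ^ 2 + 4 * N + 30)
    (by have := size_head_le Q₁; have := size_head_le Q₂; omega) hp
  set G : List Tree := (List.finRange Q₁.body.length).map fun i => matching
    (encodeSubst Q₁.terms γ) (Tree.ofList ((Q₁.body.get i).args.map Term.encode))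
    (Tree.ofList ((Q₂.body.get (μ.toFun i)).args.map Term.encode)) with hG
  have hGlen : G.length ≤ N := by
    rw [hG, List.length_map, List.length_finRange]
    exact (length_body_le Q₁).trans h₁
  refine ((hhead.mono (hlen _ ((size_head_le Q₁).trans h₁))).bind
    (B' := N * ((N + 1) * (2 * N ^ 2 + 4 * N + 30)) + (2 * N + 20))
    fun p₁ hp₁ hs₁ hg₁ => ?_).mono (by unfold mappingBound; omega)
  have hbody : Reaches (Tree.cons Q₂.encode Q₁.encode)
      (G.length * ((N + 1) * (2 * N ^ 2 + 4 * N + 30))) p₁ G := by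
    refine Reaches.list hp₁ fun g hg p' hp' hs' => ?_
    obtain ⟨i, -, rfl⟩ := List.mem_map.1 hg
    have e1 := (size_args_le (List.get_mem Q₁.body i)).trans h₁
    have e2 := (size_args_le (List.get_mem Q₂.body (μ.toFun i))).trans h₂
    exact (reaches_matching (T := Q₁.terms)
      (hmono (List.Subset.trans hs₁ hs') (happ.body i))
      (fun t ht => CQAC.mem_terms_of_body (List.get_mem _ _) ht)
      (M := 2 * N ^ 2 + 4 * N + 30) (by omega) hp').mono (hlen _ e1)
  refine (hbody.mono (Nat.mul_le_mul_right _ hGlen)).bind fun p₂ hp₂ hs₂ hg₂ => ?_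
  have hs : p ⊆ p₂ := List.Subset.trans hs₁ hs₂
  refine Reaches.of_justified hp₂ (Or.inr (Or.inr (Or.inr (Or.inr (Or.inr (Or.inr
    ⟨_, hs₂ (hg₁ List.mem_cons_self), rfl, ?_, ?_, ?_, ?_⟩)))))) (size_fact_le hT hf)
  · intro r hr r' hr' e
    obtain ⟨t, -, rfl⟩ := mem_encodeSubst.1 hr
    obtain ⟨t', -, rfl⟩ := mem_encodeSubst.1 hr'
    rw [encode_injective e]
  · intro r hr e
    obtain ⟨t, -, rfl⟩ := mem_encodeSubst.1 hr
    cases t with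
    | var x => exact absurd rfl e
    | const c => rfl
  · intro a ha
    obtain ⟨A, hA, rfl⟩ := mem_toList_map.1 ha
    obtain ⟨i, rfl⟩ := List.get_of_mem hA
    refine ⟨(Q₂.body.get (μ.toFun i)).encode, mem_toList_map.2 ⟨_, List.get_mem _ _, rfl⟩,
      congrArg Tree.ofNat (μ.rel_eq i), hg₂ (List.mem_map.2 ⟨i, List.mem_finRange i, rfl⟩)⟩
  · intro e he
    obtain ⟨c, hc, rfl⟩ := mem_toList_map.1 he
    obtain ⟨hl, hr⟩ := CQAC.mem_terms_of_comps hc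
    refine ⟨_, mem_encodeSubst.2 ⟨_, hl, rfl⟩, _, mem_encodeSubst.2 ⟨_, hr, rfl⟩, rfl, rfl, ?_⟩
    rcases happ.comps c hc with ⟨h1, h2⟩ | h1
    · exact Or.inl ⟨congrArg CompOp.encode h1, hs h2.1, hs h2.2⟩
    · exact Or.inr (refutes_encode h1)

/-- A bound for the cost of deriving one more fact. -/
def stepBound (N : ℕ) : ℕ := mappingBound N + mulLtBound (2 * N) + (2 * N + 20)

theorem closed_of_saturated {Q : CQAC} {q : Tree} {T : Set Term}
    (hT : ∀ t ∈ T, t.encode.size ≤ N) (hQT : ∀ t ∈ Q.terms, t ∈ T)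
    (hp : Derivation (Tree.cons Q.encode q) p)
    (hsat : ∀ f : Fact, f.Over T →
      Reaches (Tree.cons Q.encode q) (stepBound N) p [f.encode] → f.encode ∈ p) :
    Closed Q T (Proves p) := by
  have one : ∀ f : Fact, f.Over T → Justified (Tree.cons Q.encode q) f.encode p →
      Proves p f := fun f hf hj => hsat f hf
    ((Reaches.of_justified hp hj (size_fact_le hT hf)).mono (by unfold stepBound; omega))
  constructor
  · intro t ht
    exact one _ ⟨ht, ht⟩ (Or.inl (Or.inl ⟨rfl, Or.inl rfl⟩))
  · intro t ht u hu h
    exact one _ ⟨ht, hu⟩ (Or.inl (Or.inl ⟨rfl, Or.inr (Or.inl h)⟩))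
  · intro t ht u hu v hv h1 h2
    exact one _ ⟨ht, hv⟩ (Or.inl (Or.inl ⟨rfl, Or.inr (Or.inr ⟨_, h1, h1, h2⟩)⟩))
  · intro t ht u hu v hv h1 h2
    exact one _ ⟨ht, hv⟩ (Or.inl (Or.inr ⟨rfl, Or.inr ⟨_, h1, Or.inr ⟨h1, h2⟩⟩⟩))
  · intro t ht u hu h1 h2
    exact one _ ⟨ht, hu⟩ (Or.inl (Or.inr ⟨rfl, Or.inl ⟨h1, h2⟩⟩))
  · intro c d hc hd h
    exact hsat (Fact.lt _ _) ⟨hc, hd⟩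
      ((reaches_const h (hT _ hc) (hT _ hd) hp).mono (by unfold stepBound; omega))
  · intro e he f hf
    obtain ⟨hl, hr⟩ := CQAC.mem_terms_of_comps he
    exact one _ (CompOp.over_asserts (hQT _ hl) (hQT _ hr) f hf)
      (Or.inr (Or.inl ⟨e.encode, mem_toList_map.2 ⟨e, he, rfl⟩, asserts_encode hf⟩))

open Classical in
theorem exists_contradiction {D : Type*} [LinearOrder D] {ι : ℚ ↪o D} {Q₁ Q₂ : CQAC}
    (hc : Contained ι Q₂ Q₁) (h1 : Q₁.HasOneAC) (hN₁ : Q₁.encode.size ≤ N)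
    (hN₂ : Q₂.encode.size ≤ N) {T : Finset Term}
    (hT₁ : ∀ t ∈ Q₁.terms, t ∈ T) (hT₂ : ∀ t ∈ Q₂.terms, t ∈ T)
    (hT : ∀ t ∈ T, t.encode.size ≤ N) {S : Finset Fact} (hS : ∀ f, f.Over T → f ∈ S) (n : ℕ)
    (hp : Derivation (Tree.cons Q₂.encode Q₁.encode) p)
    (hn : (S.filter fun f => f.encode ∉ p).card ≤ n) :
    ∃ p', Derivation (Tree.cons Q₂.encode Q₁.encode) p' ∧ (∃ t, lt t t ∈ p') ∧
      (Tree.ofList p').size ≤ (Tree.ofList p).size + n * stepBound N := by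
  induction n generalizing p with
  | zero =>
    have hall : ∀ f : Fact, f.Over T → f.encode ∈ p := by
      intro f hf
      by_contra hne
      have : f ∈ S.filter fun f => f.encode ∉ p := Finset.mem_filter.2 ⟨hS f hf, hne⟩
      rw [Finset.card_eq_zero.1 (Nat.le_zero.1 hn)] at this
      simp at this
    have hcl := closed_of_saturated (T := T) hT hT₂ hp fun f hf _ => hall f hf
    by_cases hcons : ∀ t ∈ T, ¬ Proves p (Fact.lt t t)
    · obtain ⟨_, _, f, _, _, hf, hnf⟩ := hcl.exists_applicable hc h1 hT₁ hT₂ hcons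
      exact absurd (hall f hf) hnf
    · push Not at hcons
      obtain ⟨t, _, ht⟩ := hcons
      exact ⟨p, hp, ⟨_, ht⟩, by omega⟩
  | succ n ih =>
    by_cases hsat : ∀ f : Fact, f.Over T →
        Reaches (Tree.cons Q₂.encode Q₁.encode) (stepBound N) p [f.encode] → f.encode ∈ p
    · have hcl := closed_of_saturated (T := T) hT hT₂ hp hsat
      by_cases hcons : ∀ t ∈ T, ¬ Proves p (Fact.lt t t)
      · obtain ⟨μ, γ, f, happ, hγ, hf, hnf⟩ := hcl.exists_applicable hc h1 hT₁ hT₂ hcons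
        exact absurd (hsat f hf ((reaches_mapping happ hγ hT hf hN₁ hN₂ hp).mono
          (by unfold stepBound; omega))) hnf
      · push Not at hcons
        obtain ⟨t, _, ht⟩ := hcons
        exact ⟨p, hp, ⟨_, ht⟩, by omega⟩
    · push Not at hsat
      obtain ⟨f, hf, ⟨p', hp', hsub, hg, hsz⟩, hnf⟩ := hsat
      have hlt : (S.filter fun f => f.encode ∉ p').card <
          (S.filter fun f => f.encode ∉ p).card := by
        refine Finset.card_lt_card (Finset.ssubset_iff_of_subset ?_ |>.2 ⟨f, ?_, ?_⟩)
        · exact Finset.monotone_filter_right _ fun f _ hf hf' => hf (hsub hf')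
        · exact Finset.mem_filter.2 ⟨hS f hf, hnf⟩
        · exact fun H => (Finset.mem_filter.1 H).2 (hg List.mem_cons_self)
      obtain ⟨p'', h2, h3, h4⟩ := ih hp' (by omega)
      exact ⟨p'', h2, h3, by rw [Nat.succ_mul]; omega⟩

end

end Line

open Classical in
/-- The terms of both queries. -/
noncomputable def instanceTerms (a : Instance) : Finset Term :=
  (a.Q₂.terms ++ a.Q₁.terms).toFinset

theorem mem_instanceTerms {a : Instance} {t : Term} :
    t ∈ instanceTerms a ↔ t ∈ a.Q₂.terms ∨ t ∈ a.Q₁.terms := by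
  simp [instanceTerms]

theorem card_instanceTerms_le (a : Instance) : (instanceTerms a).card ≤ a.encode.size := by
  classical
  refine (List.toFinset_card_le _).trans ?_
  have h1 := length_terms_le a.Q₁
  have h2 := length_terms_le a.Q₂
  rw [List.length_append]
  simp only [Instance.encode, Tree.size]
  omega

theorem exists_facts_of_instance (a : Instance) : ∃ S : Finset Fact,
    (∀ f, f.Over (instanceTerms a) → f ∈ S) ∧ S.card ≤ 3 * a.encode.size ^ 2 := by
  obtain ⟨S, hS, hcard⟩ := exists_finset_facts (instanceTerms a)
  exact ⟨S, hS, hcard.trans (Nat.mul_le_mul_left _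
    (Nat.pow_le_pow_left (card_instanceTerms_le a) 2))⟩

theorem exists_refutation {D : Type*} [LinearOrder D] {ι : ℚ ↪o D} {a : Instance}
    (hc : Contained ι a.Q₂ a.Q₁) : ∃ y : Tree,
    y.size ≤ 1 + 3 * a.encode.size ^ 2 * Line.stepBound a.encode.size ∧
      IsRefutation (Tree.cons a.encode y) := by
  classical
  obtain ⟨S, hS, hcard⟩ := exists_facts_of_instance a
  have hsz : a.encode.size = a.Q₂.encode.size + a.Q₁.encode.size + 1 := rfl
  obtain ⟨p, hp, ⟨t, ht⟩, hle⟩ := Line.exists_contradiction (p := []) (N := a.encode.size) hc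
    a.oneAC (by omega) (by omega) (fun t ht => mem_instanceTerms.2 (Or.inr ht))
    (fun t ht => mem_instanceTerms.2 (Or.inl ht))
    (fun t ht => by
      rcases mem_instanceTerms.1 ht with h | h
      · have := size_term_le h; omega
      · have := size_term_le h; omega)
    hS _ trivial ((Finset.card_filter_le _ _).trans hcard)
  exact ⟨Tree.ofList p, hle, hp.forall_suffixes, _, by simpa using ht, rfl⟩

end CompModel

theorem mainTheorem8 {D : Type*} [LinearOrder D] [DenselyOrdered D] (ι : ℚ ↪o D) :
    CompModel.InNP CQ.Instance.encode (fun a => CQ.Contained ι a.Q₂ a.Q₁) ∧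
    ∃ p : Polynomial ℕ, ∀ a : CQ.Instance,
      CQ.Contained ι a.Q₂ a.Q₁ ↔
        ∃ L : List (CQ.ContainmentMapping a.Q₁ a.Q₂),
          L.length ≤ p.eval a.encode.size ∧ CQ.Certifies ι L := by
  classical
  constructor
  · obtain ⟨len, hlen⟩ : ∃ len : Polynomial ℕ, ∀ n,
        len.eval n = 1 + 3 * n ^ 2 * CompModel.Line.stepBound n := by
      open Polynomial in
      refine ⟨1 + 3 * X ^ 2 * (((X + 1) * (2 * X ^ 2 + 4 * X + 30) +
        X * ((X + 1) * (2 * X ^ 2 + 4 * X + 30)) + (2 * X + 20)) +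
        (2 * ((2 * X + 1) * (2 * ((2 * X + 1) * (12 * (2 * X) + 24)) + (12 * (2 * X) + 24))) +
        (2 * X + 1) * (12 * (2 * X) + 24)) + (2 * X + 20)), fun n => ?_⟩
      simp [CompModel.Line.stepBound, CompModel.Line.mappingBound, CompModel.Line.mulLtBound]
    refine CompModel.inNP_of_checkable CompModel.checkable_isRefutation len
      (fun a y hy => CompModel.contained_of_isRefutation ι hy) fun a ha => ?_
    simp only [hlen]
    exact CompModel.exists_refutation ha
  · refine ⟨3 * Polynomial.X ^ 2, fun a => ⟨fun ha => ?_, fun ⟨L, _, hL⟩ => hL.contained⟩⟩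
    obtain ⟨S, hS, hcard⟩ := CompModel.exists_facts_of_instance a
    obtain ⟨L, hlen, hL⟩ := CQ.IsOrdered.exists_certifies (L := []) ha a.oneAC
      (fun t ht => CompModel.mem_instanceTerms.2 (Or.inr ht))
      (fun t ht => CompModel.mem_instanceTerms.2 (Or.inl ht)) hS _ (fun j => j.elim0)
      ((Finset.card_filter_le _ _).trans hcard)
    exact ⟨L, by simpa using hlen, hL⟩
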